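/- Let $k$ be a field, $Q$ a finite quiver, and $I$ an admissible ideal of the path algebra $kQ$ (paths are composed from left to right) such that $(Q,I)$ is a gentle pair: (G1) every vertex is the source of at most two arrows and the target of at most two arrows; (G2) for every arrow $a$ there is at most one arrow $b$ such that $ab$ is a path not in $I$, and at most one arrow $c$ such that $ca$ is a path not in $I$; (G3) for every arrow $a$ there is at most one arrow $b$ such that $ab$ is a path lying in $I$, and at most one arrow $c$ such that $ca$ is a path lying in $I$; (G4) $I$ is generated by paths of length two. Let $A=kQ/I$ be the corresponding gentle algebra. A string is a sequence $a_1\cdots a_m$ of arrows and formal inverses of arrows, with the end of $a_i$ equal to the start of $a_{i+1}$, with no consecutive letters $a_ia_{i+1}=xy$ or $a_ia_{i+1}=y^{-1}x^{-1}$ for arrows $x,y$ with $xy\in I$, and with no consecutive letters $xx^{-1}$ or $x^{-1}x$. A band is a string $\mathbf b=a_1\cdots a_m$ with $m\ge 1$ that ends where it starts, such that $\mathbf b^2$ is a string and $\mathbf b$ is not a proper power of a string. For a band $\mathbf b=a_1\cdots a_m$, an integer $n\ge 1$ and $0\ne\lambda\in k$, let $B(n,\lambda)$ be the band module of $\mathbf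 b$: the right $A$-module with underlying space $\bigoplus_{i=1}^{m}Z_i$, $Z_i=k^n$, where $Z_i$ is placed at the starting vertex of $a_i$, and where, for $f_i:Z_i\to Z_{i+1}$ (indices modulo $m$) the identity for $i<m$ and $f_m$ the Jordan block $J_n(\lambda)$ of size $n$ with eigenvalue $\lambda$, an arrow $x$ acts on the right as the sum of all $f_i$ with $a_i=x$ and all $f_i^{-1}$ with $a_i=x^{-1}$. Then every band module $B(n,\lambda)$ over $A$ has projective dimension equal to $1$ and injective dimension equal to $1$: $$\operatorname{proj.dim} B(n,\lambda)=1=\operatorname{inj.dim} B(n,\lambda).$$ -/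

import Mathlib

open CategoryTheory

universe u v w

noncomputable section

namespace GentleAlg

/-! ## Path algebras -/

/-- A path of a quiver together with its source and its target
(paths of length zero are the trivial paths at the vertices). -/
structure PathOf (V : Type v) [Quiver.{w} V] where
  /-- the starting point -/
  src : V
  /-- the ending point -/
  tgt : V
  /-- the path; it is read from left to right -/
  path : Quiver.Path src tgt

/-- The underlying vector space of the path algebra: the paths form a basis. -/
def PathAlgebra (k : Type u) [Field k] (V : Type v) [Quiver.{w} V] : Type (max u v w) :=
  PathOf V →₀ k

section PathAlgebra

variable (k : Type u) [Field k] {V : Type v} [Quiver.{w} V]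

instance : AddCommGroup (PathAlgebra k V) := inferInstanceAs (AddCommGroup (PathOf V →₀ k))

instance : Module k (PathAlgebra k V) := inferInstanceAs (Module k (PathOf V →₀ k))

/-- The basis vector of the path algebra given by a path. -/
def ofPath (p : PathOf V) : PathAlgebra k V := Finsupp.single p 1

/-- The trivial path `ε_v`. -/
def idem (v : V) : PathAlgebra k V := ofPath k ⟨v, v, Quiver.Path.nil⟩

/-- An arrow, as a path of length one. -/
def ofArrow (a : Quiver.Total V) : PathAlgebra k V := ofPath k ⟨a.left, a.right, a.hom.toPath⟩

open Classical in
/-- The product `p q` of two paths: first `p`, then `q` if `p` ends where `q` starts,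
and `0` otherwise. -/
def pathMul (p q : PathOf V) : PathAlgebra k V :=
  if h : p.tgt = q.src then ofPath k ⟨p.src, q.tgt, p.path.comp (q.path.cast h.symm rfl)⟩ else 0

variable {k}

/-- Two linear maps out of the path algebra agree if they agree on paths. -/
theorem PathAlgebra.hom_ext {M : Type*} [AddCommGroup M] [Module k M]
    {f g : PathAlgebra k V →ₗ[k] M} (h : ∀ p, f (ofPath k p) = g (ofPath k p)) : f = g :=
  Finsupp.lhom_ext' fun p => LinearMap.ext_ring (h p)

/-- The linear map out of the path algebra with prescribed values on the paths. -/
def linLift {M : Type*} [AddCommGroup M] [Module k M] (φ : PathOf V → M) :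
    PathAlgebra k V →ₗ[k] M :=
  Finsupp.linearCombination k φ

theorem linLift_ofPath {M : Type*} [AddCommGroup M] [Module k M] (φ : PathOf V → M)
    (p : PathOf V) : linLift φ (ofPath k p) = φ p :=
  (Finsupp.linearCombination_single k (1 : k) p).trans (one_smul k _)

/-- The multiplication as a bilinear map: the bilinear extension of the product of paths. -/
def mulBilin : PathAlgebra k V →ₗ[k] PathAlgebra k V →ₗ[k] PathAlgebra k V :=
  linLift fun p => linLift fun q => pathMul k p q

instance : Mul (PathAlgebra k V) := ⟨fun x y => mulBilin x y⟩

theorem PathAlgebra.mul_def (x y : PathAlgebra k V) : x * y = mulBilin x y := rfl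

theorem ofPath_mul_ofPath (p q : PathOf V) : ofPath k p * ofPath k q = pathMul k p q := by
  rw [PathAlgebra.mul_def, mulBilin, linLift_ofPath, linLift_ofPath]

theorem ofPath_mul_comp {a b c : V} (p : Quiver.Path a b) (q : Quiver.Path b c) :
    ofPath k ⟨a, b, p⟩ * ofPath k ⟨b, c, q⟩ = ofPath k ⟨a, c, p.comp q⟩ := by
  rw [ofPath_mul_ofPath, pathMul, dif_pos rfl]; rfl

theorem ofPath_mul_of_ne {p q : PathOf V} (h : p.tgt ≠ q.src) :
    ofPath k p * ofPath k q = 0 := by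
  rw [ofPath_mul_ofPath, pathMul, dif_neg h]

theorem PathAlgebra.zero_mul' (x : PathAlgebra k V) : 0 * x = 0 := by
  simp [PathAlgebra.mul_def]

theorem PathAlgebra.mul_zero' (x : PathAlgebra k V) : x * 0 = 0 := by
  simp [PathAlgebra.mul_def]

theorem PathAlgebra.mul_assoc_ofPath (p q r : PathOf V) :
    ofPath k p * ofPath k q * ofPath k r = ofPath k p * (ofPath k q * ofPath k r) := by
  obtain ⟨a, b, p⟩ := p
  obtain ⟨b', c, q⟩ := q
  obtain ⟨c', d, r⟩ := r
  by_cases h1 : b = b'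
  · subst h1
    by_cases h2 : c = c'
    · subst h2
      simp only [ofPath_mul_comp, Quiver.Path.comp_assoc]
    · rw [ofPath_mul_comp, ofPath_mul_of_ne (by exact h2), ofPath_mul_of_ne (by exact h2),
        PathAlgebra.mul_zero']
  · rw [ofPath_mul_of_ne (by exact h1), PathAlgebra.zero_mul']
    by_cases h2 : c = c'
    · subst h2
      rw [ofPath_mul_comp, ofPath_mul_of_ne (by exact h1)]
    · rw [ofPath_mul_of_ne (p := ⟨b', c, q⟩) (by exact h2), PathAlgebra.mul_zero']

theorem PathAlgebra.mul_assoc' (x y z : PathAlgebra k V) : x * y * z = x * (y * z) := by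
  have : (LinearMap.compr₂ mulBilin mulBilin :
        PathAlgebra k V →ₗ[k] PathAlgebra k V →ₗ[k] PathAlgebra k V →ₗ[k] PathAlgebra k V)
      = (LinearMap.llcomp k _ _ _ ∘ₗ mulBilin).compl₂ mulBilin := by
    refine PathAlgebra.hom_ext fun p => PathAlgebra.hom_ext fun q =>
      PathAlgebra.hom_ext fun r => ?_
    exact PathAlgebra.mul_assoc_ofPath p q r
  exact LinearMap.congr_fun (LinearMap.congr_fun (LinearMap.congr_fun this x) y) z

theorem PathAlgebra.idem_mul_ofPath [DecidableEq V] (x : V) (p : PathOf V) :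
    idem k x * ofPath k p = if x = p.src then ofPath k p else 0 := by
  obtain ⟨a, b, p⟩ := p
  split_ifs with h
  · have h' : x = a := h
    subst h'
    rw [idem, ofPath_mul_comp, Quiver.Path.nil_comp]
  · exact ofPath_mul_of_ne h

theorem PathAlgebra.ofPath_mul_idem [DecidableEq V] (x : V) (p : PathOf V) :
    ofPath k p * idem k x = if p.tgt = x then ofPath k p else 0 := by
  obtain ⟨a, b, p⟩ := p
  split_ifs with h
  · have h' : b = x := h
    subst h'
    rw [idem, ofPath_mul_comp, Quiver.Path.comp_nil]
  · exact ofPath_mul_of_ne h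

section Unital

variable [Fintype V]

/-- The unit of the path algebra of a quiver with finitely many vertices is the sum of the trivial
paths. -/
instance : One (PathAlgebra k V) := ⟨∑ v, idem k v⟩

theorem PathAlgebra.one_def : (1 : PathAlgebra k V) = ∑ v, idem k v := rfl

theorem PathAlgebra.one_mul' (x : PathAlgebra k V) : 1 * x = x := by
  classical
  have : mulBilin (1 : PathAlgebra k V) = LinearMap.id := by
    refine PathAlgebra.hom_ext fun p => ?_
    rw [PathAlgebra.one_def, map_sum, LinearMap.sum_apply]
    simp only [← PathAlgebra.mul_def, PathAlgebra.idem_mul_ofPath]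
    simp
  exact LinearMap.congr_fun this x

theorem PathAlgebra.mul_one' (x : PathAlgebra k V) : x * 1 = x := by
  classical
  have : mulBilin.flip (1 : PathAlgebra k V) = LinearMap.id := by
    refine PathAlgebra.hom_ext fun p => ?_
    rw [PathAlgebra.one_def, map_sum, LinearMap.sum_apply]
    simp only [LinearMap.flip_apply, ← PathAlgebra.mul_def, PathAlgebra.ofPath_mul_idem]
    simp
  exact LinearMap.congr_fun this x

instance : Ring (PathAlgebra k V) :=
  { (inferInstance : AddCommGroup (PathAlgebra k V)), (inferInstance : Mul (PathAlgebra k V)),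
    (inferInstance : One (PathAlgebra k V)) with
    mul_assoc := PathAlgebra.mul_assoc'
    one_mul := PathAlgebra.one_mul'
    mul_one := PathAlgebra.mul_one'
    zero_mul := PathAlgebra.zero_mul'
    mul_zero := PathAlgebra.mul_zero'
    left_distrib := fun x y z => by simp [PathAlgebra.mul_def]
    right_distrib := fun x y z => by simp [PathAlgebra.mul_def] }

instance : Algebra k (PathAlgebra k V) :=
  Algebra.ofModule (fun r x y => by simp [PathAlgebra.mul_def])
    (fun r x y => by simp [PathAlgebra.mul_def])

end Unital

end PathAlgebra

/-! ## Gentle pairs -/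

section Gentle

variable {k : Type u} [Field k] {V : Type v} [Quiver.{w} V]

variable (k V) in
/-- The `m`-th power of the arrow ideal: the linear combinations of paths of length at
least `m`. -/
def arrowIdealPow (m : ℕ) : Submodule k (PathAlgebra k V) :=
  Submodule.span k {x | ∃ p : PathOf V, m ≤ p.path.length ∧ x = ofPath k p}

variable [Fintype V]

/-- Admissible ideals of the path algebra: `R ^ m ⊆ I ⊆ R ^ 2` for some `m ≥ 2`,
where `R` is the arrow ideal. -/
def IsAdmissible (I : TwoSidedIdeal (PathAlgebra k V)) : Prop :=
  (∃ m, 2 ≤ m ∧ ∀ x ∈ arrowIdealPow k V m, x ∈ I) ∧ ∀ x ∈ I, x ∈ arrowIdealPow k V 2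

/-- `ab` is a path (of length two). -/
def Composable (a b : Quiver.Total V) : Prop := a.right = b.left

/-- `(Q, I)` is a gentle pair, where `Q` is the quiver on the finite vertex set `V`. It has finitely
many arrows by `out_le`, and `kQ / I` is then finite-dimensional because `I` is admissible. -/
structure IsGentlePair (I : TwoSidedIdeal (PathAlgebra k V)) : Prop where
  admissible : IsAdmissible I
  /-- every vertex is the source of at most two arrows -/
  out_le : ∀ x : V, {a : Quiver.Total V | a.left = x}.encard ≤ 2
  /-- every vertex is the target of at most two arrows -/
  in_le : ∀ x : V, {a : Quiver.Total V | a.right = x}.encard ≤ 2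
  /-- for every `a` there is at most one `b` with `ab ∉ I` -/
  right_not_mem : ∀ a b b' : Quiver.Total V, Composable a b → Composable a b' →
    ofArrow k a * ofArrow k b ∉ I → ofArrow k a * ofArrow k b' ∉ I → b = b'
  /-- for every `a` there is at most one `c` with `ca ∉ I` -/
  left_not_mem : ∀ a c c' : Quiver.Total V, Composable c a → Composable c' a →
    ofArrow k c * ofArrow k a ∉ I → ofArrow k c' * ofArrow k a ∉ I → c = c'
  /-- for every `a` there is at most one `b` such that `ab` is a path in `I` -/
  right_mem : ∀ a b b' : Quiver.Total V, Composable a b → Composable a b' →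
    ofArrow k a * ofArrow k b ∈ I → ofArrow k a * ofArrow k b' ∈ I → b = b'
  /-- for every `a` there is at most one `c` such that `ca` is a path in `I` -/
  left_mem : ∀ a c c' : Quiver.Total V, Composable c a → Composable c' a →
    ofArrow k c * ofArrow k a ∈ I → ofArrow k c' * ofArrow k a ∈ I → c = c'
  /-- `I` is generated by paths of length two -/
  generated : ∃ S : Set (Quiver.Total V × Quiver.Total V), (∀ p ∈ S, Composable p.1 p.2) ∧
    I = TwoSidedIdeal.span ((fun p => ofArrow k p.1 * ofArrow k p.2) '' S)

/-- The bound quiver algebra `A = kQ / I`. -/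
abbrev BoundAlgebra (I : TwoSidedIdeal (PathAlgebra k V)) : Type (max u v w) :=
  I.ringCon.Quotient

end Gentle

/-! ## Strings and bands -/

/-- Arrows and formal inverses of arrows. -/
inductive Letter (V : Type v) [Quiver.{w} V] : Type (max v w)
  | dir (a : Quiver.Total V) : Letter V
  | inv (a : Quiver.Total V) : Letter V

namespace Letter

variable {V : Type v} [Quiver.{w} V]

/-- The starting point of a letter. -/
def src : Letter V → V
  | dir a => a.left
  | inv a => a.right

/-- The ending point of a letter. -/
def tgt : Letter V → V
  | dir a => a.right
  | inv a => a.left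

end Letter

section Strings

variable {k : Type u} [Field k] {V : Type v} [Quiver.{w} V] [Fintype V]

/-- There is no relation in `x y`: `ab ∉ I` if `x y = a b`, and `ba ∉ I` if
`x y = a⁻¹ b⁻¹`. -/
def NoRelation (I : TwoSidedIdeal (PathAlgebra k V)) : Letter V → Letter V → Prop
  | .dir a, .dir b => ofArrow k a * ofArrow k b ∉ I
  | .inv a, .inv b => ofArrow k b * ofArrow k a ∉ I
  | _, _ => True

/-- `x` and `y` are not mutually inverse. -/
def NoBacktrack : Letter V → Letter V → Prop
  | .dir a, .inv b => a ≠ b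
  | .inv a, .dir b => a ≠ b
  | _, _ => True

/-- The letter `y` may follow the letter `x` in a string. -/
def CanFollow (I : TwoSidedIdeal (PathAlgebra k V)) (x y : Letter V) : Prop :=
  x.tgt = y.src ∧ NoRelation I x y ∧ NoBacktrack x y

/-- Strings (the empty list is the trivial string). -/
def IsString (I : TwoSidedIdeal (PathAlgebra k V)) (s : List (Letter V)) : Prop :=
  s.IsChain (CanFollow I)

/-- Bands. -/
structure IsBand (I : TwoSidedIdeal (PathAlgebra k V)) (b : List (Letter V)) : Prop where
  ne_nil : b ≠ []
  isString : IsString I b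
  /-- `b` ends where it starts -/
  closed : ∀ x ∈ b.getLast?, ∀ y ∈ b.head?, x.tgt = y.src
  /-- `b` is not a proper power of a string -/
  not_power : ∀ s : List (Letter V), IsString I s → ∀ r : ℕ, 2 ≤ r →
    b ≠ (List.replicate r s).flatten
  /-- `b ^ 2` is a string -/
  isString_sq : IsString I (b ++ b)

end Strings

/-! ## Band modules -/

/-- The Jordan block of size `n` with eigenvalue `l` (`l` on the diagonal and `1` just
above it). -/
def jordanBlock {k : Type u} [Field k] (n : ℕ) (l : k) : Matrix (Fin n) (Fin n) k :=
  Matrix.of fun i j => if i = j then l else if (i : ℕ) + 1 = j then 1 else 0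

section Rep

variable {k : Type u} [Field k] {V : Type v} [Quiver.{w} V]

/-- The position following `i` in the cyclic order. -/
def nextPos {m : ℕ} (i : Fin m) : Fin m := ⟨(i + 1) % m, Nat.mod_lt _ i.pos⟩

/-- The vector space underlying a band module: one copy of `k ^ n` for each letter of the
band `b`, placed at the starting point of this letter. -/
abbrev BandSpace (k : Type u) (b : List (Letter V)) (n : ℕ) : Type u :=
  Fin b.length → Fin n → k

/-- The map from the `i`-th to the next copy of `k ^ n` that is attached to the `i`-th letter:
it is the identity, except for the last letter, where it is `J`. -/
def bandMat (b : List (Letter V)) {n : ℕ} (J : Matrix (Fin n) (Fin n) k) (i : Fin b.length) :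
    Matrix (Fin n) (Fin n) k :=
  if (i : ℕ) + 1 = b.length then J else 1

open Classical in
/-- The action of `ε_v`: the projection to the copies of `k ^ n` placed at the vertex `v`. -/
def bandIdem (b : List (Letter V)) (n : ℕ) (x : V) :
    BandSpace k b n →ₗ[k] BandSpace k b n :=
  LinearMap.pi fun i => if (b.get i).src = x then LinearMap.proj i else 0

/-- The summand of the action of the arrow `a` contributed by the letter at position `i`. -/
def bandStep (b : List (Letter V)) {n : ℕ} (J : Matrix (Fin n) (Fin n) k)
    (a : Quiver.Total V) (i : Fin b.length) : BandSpace k b n →ₗ[k] BandSpace k b n :=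
  open Classical in
  match b.get i with
  | .dir c => if c = a then
      LinearMap.single k (fun _ => Fin n → k) (nextPos i) ∘ₗ
        (bandMat b J i).mulVecLin ∘ₗ LinearMap.proj i else 0
  | .inv c => if c = a then
      LinearMap.single k (fun _ => Fin n → k) i ∘ₗ
        (bandMat b J i)⁻¹.mulVecLin ∘ₗ LinearMap.proj (nextPos i) else 0

/-- The action of an arrow `a`: if the `i`-th letter is `a`, then `a` maps the `i`-th
copy of `k ^ n` to the next one by the matrix of that letter; if the `i`-th letter is `a⁻¹`,
then `a` maps the next copy back to the `i`-th one by the inverse matrix. -/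
def bandArrow (b : List (Letter V)) {n : ℕ} (J : Matrix (Fin n) (Fin n) k)
    (a : Quiver.Total V) : BandSpace k b n →ₗ[k] BandSpace k b n :=
  ∑ i, bandStep b J a i

/-- The action of a path (on the right): its arrows act one after the other, from left to
right. -/
def bandPath (b : List (Letter V)) {n : ℕ} (J : Matrix (Fin n) (Fin n) k) {x : V} :
    {y : V} → Quiver.Path x y → (BandSpace k b n →ₗ[k] BandSpace k b n)
  | _, .nil => bandIdem b n x
  | _, .cons p f => bandArrow b J ⟨_, _, f⟩ ∘ₗ bandPath b J p

theorem comp_sum_end {ι M : Type*} [AddCommGroup M] [Module k M] (s : Finset ι)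
    (f : M →ₗ[k] M) (g : ι → (M →ₗ[k] M)) : f ∘ₗ ∑ i ∈ s, g i = ∑ i ∈ s, f ∘ₗ g i :=
  Finset.mul_sum (R := Module.End k M) s g f

theorem sum_comp_end {ι M : Type*} [AddCommGroup M] [Module k M] (s : Finset ι)
    (f : M →ₗ[k] M) (g : ι → (M →ₗ[k] M)) : (∑ i ∈ s, g i) ∘ₗ f = ∑ i ∈ s, g i ∘ₗ f :=
  Finset.sum_mul (R := Module.End k M) s g f

theorem bandIdem_comp_single (b : List (Letter V)) (n : ℕ) (x : V) (j : Fin b.length)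
    [Decidable ((b.get j).src = x)] :
    bandIdem b n x ∘ₗ LinearMap.single k (fun _ => Fin n → k) j =
      if (b.get j).src = x then LinearMap.single k (fun _ => Fin n → k) j else 0 := by
  refine LinearMap.ext fun z => funext fun i => ?_
  by_cases hij : i = j
  · subst hij
    by_cases h : (b.get i).src = x
    · rw [if_pos h]; simp only [bandIdem, LinearMap.comp_apply, LinearMap.pi_apply, if_pos h]; rfl
    · rw [if_neg h]; simp only [bandIdem, LinearMap.comp_apply, LinearMap.pi_apply, if_neg h]; rfl
  · have h0 : (Pi.single j z : BandSpace k b n) i = 0 := Pi.single_eq_of_ne (M := fun _ => Fin n → k) hij z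
    have : (bandIdem b n x (Pi.single j z : BandSpace k b n)) i = 0 := by
      simp only [bandIdem, LinearMap.pi_apply]
      split_ifs
      · exact h0
      · rfl
    refine this.trans ?_
    split_ifs
    · exact h0.symm
    · rfl

theorem proj_comp_bandIdem (b : List (Letter V)) (n : ℕ) (x : V) (j : Fin b.length)
    [Decidable ((b.get j).src = x)] :
    (LinearMap.proj j : BandSpace k b n →ₗ[k] _) ∘ₗ bandIdem b n x =
      if (b.get j).src = x then LinearMap.proj j else 0 := by
  refine LinearMap.ext fun z => ?_
  simp only [bandIdem, LinearMap.comp_apply, LinearMap.proj_apply, LinearMap.pi_apply]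
  split_ifs <;> rfl

theorem bandIdem_comp_bandIdem (b : List (Letter V)) (n : ℕ) (x y : V) [Decidable (x = y)] :
    bandIdem b n y ∘ₗ bandIdem b n x =
      if x = y then (bandIdem b n x : BandSpace k b n →ₗ[k] _) else 0 := by
  refine LinearMap.ext fun z => funext fun i => ?_
  by_cases h : x = y
  · subst h
    rw [if_pos rfl]
    simp only [bandIdem, LinearMap.comp_apply, LinearMap.pi_apply]
    split_ifs with h
    · simp only [LinearMap.proj_apply, LinearMap.pi_apply, if_pos h]
    · rfl
  · rw [if_neg h]
    simp only [bandIdem, LinearMap.comp_apply, LinearMap.pi_apply]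
    split_ifs with h2
    · have h3 : (b.get i).src ≠ x := fun e => h (e.symm.trans h2)
      simp only [LinearMap.proj_apply, LinearMap.pi_apply, if_neg h3]
      rfl
    · rfl

theorem sum_bandIdem [Fintype V] (b : List (Letter V)) (n : ℕ) :
    ∑ x, (bandIdem b n x : BandSpace k b n →ₗ[k] _) = LinearMap.id := by
  classical
  refine LinearMap.ext fun z => funext fun i => ?_
  rw [LinearMap.sum_apply, Finset.sum_apply, Finset.sum_eq_single (b.get i).src]
  · simp only [bandIdem, LinearMap.pi_apply, if_pos]; rfl
  · intro x _ hx
    simp only [bandIdem, LinearMap.pi_apply, if_neg hx.symm]; rfl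
  · simp

/-- Consecutive letters of `b`, read cyclically, can be composed. -/
def CyclicallyComposable (b : List (Letter V)) : Prop :=
  ∀ i : Fin b.length, (b.get i).tgt = (b.get (nextPos i)).src

theorem bandIdem_comp_bandArrow {b : List (Letter V)} (hb : CyclicallyComposable b) {n : ℕ}
    (J : Matrix (Fin n) (Fin n) k) (a : Quiver.Total V) (x : V) [Decidable (a.right = x)] :
    bandIdem b n x ∘ₗ bandArrow b J a = if a.right = x then bandArrow b J a else 0 := by
  classical
  have key : ∀ i, bandIdem b n x ∘ₗ bandStep b J a i =
      if a.right = x then bandStep b J a i else 0 := by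
    intro i
    have hi := hb i
    unfold bandStep
    split
    · rename_i c hc
      rw [hc] at hi
      split_ifs with h1 h2 h2
      · subst h1
        rw [← LinearMap.comp_assoc, bandIdem_comp_single, if_pos (hi.symm.trans h2)]
      · subst h1
        rw [← LinearMap.comp_assoc, bandIdem_comp_single, if_neg (fun e => h2 (hi.trans e)),
          LinearMap.zero_comp]
      · exact LinearMap.comp_zero _
      · exact LinearMap.comp_zero _
    · rename_i c hc
      have hs : (b.get i).src = c.right := by rw [hc]; rfl
      split_ifs with h1 h2 h2
      · subst h1
        rw [← LinearMap.comp_assoc, bandIdem_comp_single, if_pos (hs.trans h2)]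
      · subst h1
        rw [← LinearMap.comp_assoc, bandIdem_comp_single, if_neg (fun e => h2 (hs.symm.trans e)),
          LinearMap.zero_comp]
      · exact LinearMap.comp_zero _
      · exact LinearMap.comp_zero _
  unfold bandArrow
  rw [comp_sum_end, Finset.sum_congr rfl fun i _ => key i]
  split_ifs <;> simp

theorem bandArrow_comp_bandIdem {b : List (Letter V)} (hb : CyclicallyComposable b) {n : ℕ}
    (J : Matrix (Fin n) (Fin n) k) (a : Quiver.Total V) (x : V) [Decidable (a.left = x)] :
    bandArrow b J a ∘ₗ bandIdem b n x = if a.left = x then bandArrow b J a else 0 := by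
  classical
  have key : ∀ i, bandStep b J a i ∘ₗ bandIdem b n x =
      if a.left = x then bandStep b J a i else 0 := by
    intro i
    have hi := hb i
    unfold bandStep
    split
    · rename_i c hc
      have hs : (b.get i).src = c.left := by rw [hc]; rfl
      split_ifs with h1 h2 h2
      · subst h1
        rw [LinearMap.comp_assoc, LinearMap.comp_assoc, proj_comp_bandIdem, if_pos (hs.trans h2)]
      · subst h1
        rw [LinearMap.comp_assoc, LinearMap.comp_assoc, proj_comp_bandIdem,
          if_neg (fun e => h2 (hs.symm.trans e)), LinearMap.comp_zero, LinearMap.comp_zero]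
      · exact LinearMap.zero_comp _
      · exact LinearMap.zero_comp _
    · rename_i c hc
      rw [hc] at hi
      split_ifs with h1 h2 h2
      · subst h1
        rw [LinearMap.comp_assoc, LinearMap.comp_assoc, proj_comp_bandIdem,
          if_pos (hi.symm.trans h2)]
      · subst h1
        rw [LinearMap.comp_assoc, LinearMap.comp_assoc, proj_comp_bandIdem,
          if_neg (fun e => h2 (hi.trans e)), LinearMap.comp_zero, LinearMap.comp_zero]
      · exact LinearMap.zero_comp _
      · exact LinearMap.zero_comp _
  unfold bandArrow
  rw [sum_comp_end, Finset.sum_congr rfl fun i _ => key i]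
  split_ifs <;> simp

theorem bandIdem_comp_bandPath {b : List (Letter V)} (hb : CyclicallyComposable b) {n : ℕ}
    (J : Matrix (Fin n) (Fin n) k) {x y : V} (p : Quiver.Path x y) (z : V) [Decidable (y = z)] :
    bandIdem b n z ∘ₗ bandPath b J p = if y = z then bandPath b J p else 0 := by
  cases p with
  | nil => exact bandIdem_comp_bandIdem b n x z
  | cons p f =>
    simp only [bandPath]
    rw [← LinearMap.comp_assoc, bandIdem_comp_bandArrow hb]
    split_ifs
    · rfl
    · exact LinearMap.zero_comp _

theorem bandPath_comp_bandIdem (b : List (Letter V)) {n : ℕ}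
    (J : Matrix (Fin n) (Fin n) k) {x y : V} (p : Quiver.Path x y) (z : V) [Decidable (x = z)] :
    bandPath b J p ∘ₗ bandIdem b n z = if x = z then bandPath b J p else 0 := by
  induction p with
  | nil =>
    simp only [bandPath]
    by_cases h : x = z
    · subst h
      classical
      rw [bandIdem_comp_bandIdem, if_pos rfl]
    · classical
      rw [bandIdem_comp_bandIdem, if_neg (Ne.symm h), if_neg h]
  | cons p f ih =>
    simp only [bandPath]
    rw [LinearMap.comp_assoc, ih]
    split_ifs
    · rfl
    · exact LinearMap.comp_zero _

theorem bandPath_comp {b : List (Letter V)} (hb : CyclicallyComposable b) {n : ℕ}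
    (J : Matrix (Fin n) (Fin n) k) {x y z : V} (p : Quiver.Path x y) (q : Quiver.Path y z) :
    bandPath b J (p.comp q) = bandPath b J q ∘ₗ bandPath b J p := by
  classical
  induction q with
  | nil => exact ((bandIdem_comp_bandPath hb J p y).trans (if_pos rfl)).symm
  | cons q f ih =>
    simp only [Quiver.Path.comp, bandPath]
    rw [ih, LinearMap.comp_assoc]

/-- The right action of the path algebra on the band space, as a linear map. -/
def bandLin (b : List (Letter V)) {n : ℕ} (J : Matrix (Fin n) (Fin n) k) :
    PathAlgebra k V →ₗ[k] Module.End k (BandSpace k b n) :=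
  linLift fun p => bandPath b J p.path

theorem bandLin_ofPath (b : List (Letter V)) {n : ℕ} (J : Matrix (Fin n) (Fin n) k)
    (p : PathOf V) : bandLin b J (ofPath k p) = bandPath b J p.path :=
  linLift_ofPath _ p

theorem bandLin_mul {b : List (Letter V)} (hb : CyclicallyComposable b) {n : ℕ}
    (J : Matrix (Fin n) (Fin n) k) (r s : PathAlgebra k V) :
    bandLin b J (r * s) = bandLin b J s * bandLin b J r := by
  classical
  have : LinearMap.compr₂ mulBilin (bandLin b J) =
      (LinearMap.mul k (Module.End k (BandSpace k b n))).flip.compl₁₂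
        (bandLin b J) (bandLin b J) := by
    refine PathAlgebra.hom_ext fun p => PathAlgebra.hom_ext fun q => ?_
    change bandLin b J (ofPath k p * ofPath k q) =
      bandLin b J (ofPath k q) * bandLin b J (ofPath k p)
    obtain ⟨x, y, p⟩ := p
    obtain ⟨y', z, q⟩ := q
    by_cases h : y = y'
    · subst h
      rw [ofPath_mul_comp, bandLin_ofPath, bandLin_ofPath, bandLin_ofPath]
      exact bandPath_comp hb J p q
    · rw [ofPath_mul_of_ne (by exact h), map_zero, bandLin_ofPath, bandLin_ofPath]
      have h1 : bandPath b J q = bandPath b J q ∘ₗ bandIdem b n y' := by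
        rw [bandPath_comp_bandIdem, if_pos rfl]
      change 0 = bandPath b J q ∘ₗ bandPath b J p
      rw [h1, LinearMap.comp_assoc, bandIdem_comp_bandPath hb, if_neg h, LinearMap.comp_zero]
  exact LinearMap.congr_fun (LinearMap.congr_fun this r) s

theorem bandLin_ofArrow {b : List (Letter V)} (hb : CyclicallyComposable b) {n : ℕ}
    (J : Matrix (Fin n) (Fin n) k) (a : Quiver.Total V) :
    bandLin b J (ofArrow k a) = bandArrow b J a := by
  classical
  rw [ofArrow, bandLin_ofPath]
  exact (bandArrow_comp_bandIdem hb J a a.left).trans (if_pos rfl)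

variable [Fintype V]

theorem bandLin_one (b : List (Letter V)) {n : ℕ} (J : Matrix (Fin n) (Fin n) k) :
    bandLin b J (1 : PathAlgebra k V) = 1 := by
  rw [PathAlgebra.one_def, map_sum]
  simp only [idem, bandLin_ofPath]
  exact sum_bandIdem b n

/-- The right action of the path algebra on the band space, as a ring homomorphism to the
opposite of the endomorphism ring. -/
def bandHom {b : List (Letter V)} (hb : CyclicallyComposable b) {n : ℕ}
    (J : Matrix (Fin n) (Fin n) k) :
    PathAlgebra k V →+* (Module.End k (BandSpace k b n))ᵐᵒᵖ where
  toFun r := MulOpposite.op (bandLin b J r)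
  map_one' := by rw [bandLin_one, MulOpposite.op_one]
  map_mul' r s := by rw [bandLin_mul hb, MulOpposite.op_mul]
  map_zero' := by rw [map_zero, MulOpposite.op_zero]
  map_add' r s := by rw [map_add, MulOpposite.op_add]

theorem IsBand.canFollow {I : TwoSidedIdeal (PathAlgebra k V)} {b : List (Letter V)}
    (hb : IsBand I b) (i : Fin b.length) : CanFollow I (b.get i) (b.get (nextPos i)) := by
  have h := List.isChain_iff_getElem.1 hb.isString_sq i (by
    have := i.2
    simp only [List.length_append]; omega)
  have h1 : (b ++ b)[(i : ℕ)]'(by have := i.2; simp only [List.length_append]; omega) =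
      b.get i := by
    rw [List.getElem_append_left i.2]; rfl
  have h2 : (b ++ b)[(i : ℕ) + 1]'(by have := i.2; simp only [List.length_append]; omega) =
      b.get (nextPos i) := by
    by_cases hi : (i : ℕ) + 1 < b.length
    · rw [List.getElem_append_left hi]
      simp only [nextPos, List.get_eq_getElem, Nat.mod_eq_of_lt hi]
    · have hi' : (i : ℕ) + 1 = b.length := by have := i.2; omega
      rw [List.getElem_append_right (by omega)]
      simp only [nextPos, List.get_eq_getElem, hi', Nat.mod_self, Nat.sub_self]
  rwa [h1, h2] at h

theorem IsBand.cyclicallyComposable {I : TwoSidedIdeal (PathAlgebra k V)}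
    {b : List (Letter V)} (hb : IsBand I b) : CyclicallyComposable b :=
  fun i => (hb.canFollow i).1

theorem nextPos_injective {m : ℕ} : Function.Injective (nextPos : Fin m → Fin m) := by
  intro i j h
  have h' : ((i : ℕ) + 1) % m = ((j : ℕ) + 1) % m := congrArg Fin.val h
  exact Fin.ext (Nat.ModEq.eq_of_lt_of_lt (Nat.ModEq.add_right_cancel' 1 h') i.2 j.2)

theorem proj_comp_single_of_ne {m n : ℕ} {i j : Fin m} (h : i ≠ j) :
    (LinearMap.proj i : (Fin m → Fin n → k) →ₗ[k] _) ∘ₗ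
      LinearMap.single k (fun _ => Fin n → k) j = 0 :=
  LinearMap.ext fun z => Pi.single_eq_of_ne (M := fun _ => Fin n → k) h z

/-- Relations act as zero. -/
theorem bandArrow_comp_bandArrow_of_mem {I : TwoSidedIdeal (PathAlgebra k V)}
    {b : List (Letter V)} (hb : IsBand I b) {n : ℕ} (J : Matrix (Fin n) (Fin n) k)
    (a c : Quiver.Total V) (h : ofArrow k a * ofArrow k c ∈ I) :
    bandArrow b J c ∘ₗ bandArrow b J a = 0 := by
  classical
  unfold bandArrow
  rw [sum_comp_end]
  refine Finset.sum_eq_zero fun i _ => ?_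
  rw [comp_sum_end]
  refine Finset.sum_eq_zero fun j _ => ?_
  -- the letter at `j` acts first
  have key : ∀ (P Q : Fin b.length) (A B : (Fin n → k) →ₗ[k] (Fin n → k))
      (S T : Fin b.length), P ≠ Q →
      (LinearMap.single k (fun _ => Fin n → k) S ∘ₗ A ∘ₗ
        (LinearMap.proj P : BandSpace k b n →ₗ[k] _)) ∘ₗ
      (LinearMap.single k (fun _ => Fin n → k) Q ∘ₗ B ∘ₗ
        (LinearMap.proj T : BandSpace k b n →ₗ[k] _)) = 0 := by
    intro P Q A B S T hPQ
    have := proj_comp_single_of_ne (k := k) (n := n) hPQ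
    rw [LinearMap.comp_assoc, LinearMap.comp_assoc, ← LinearMap.comp_assoc _ _ (LinearMap.proj P),
      this, LinearMap.zero_comp, LinearMap.comp_zero, LinearMap.comp_zero]
  unfold bandStep
  split <;> rename_i c' hc' <;> split_ifs with h1
  · subst h1
    split <;> rename_i a' ha' <;> split_ifs with h2
    · subst h2
      refine key _ _ _ _ _ _ fun e => ?_
      have := (hb.canFollow j).2.1
      rw [ha', ← e, hc'] at this
      exact this h
    · exact LinearMap.comp_zero _
    · refine key _ _ _ _ _ _ fun e => ?_
      rw [e, ha'] at hc'
      cases hc'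
    · exact LinearMap.comp_zero _
  · exact LinearMap.zero_comp _
  · subst h1
    split <;> rename_i a' ha' <;> split_ifs with h2
    · refine key _ _ _ _ _ _ fun e => ?_
      rw [nextPos_injective e, ha'] at hc'
      cases hc'
    · exact LinearMap.comp_zero _
    · subst h2
      refine key _ _ _ _ _ _ fun e => ?_
      have := (hb.canFollow i).2.1
      rw [hc', e, ha'] at this
      exact this h
    · exact LinearMap.comp_zero _
  · exact LinearMap.zero_comp _

theorem bandHom_ker {I : TwoSidedIdeal (PathAlgebra k V)} (hI : IsGentlePair I)
    {b : List (Letter V)} (hb : IsBand I b) {n : ℕ} (J : Matrix (Fin n) (Fin n) k) :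
    I.ringCon ≤ RingCon.ker (bandHom hb.cyclicallyComposable J) := by
  have hle : I ≤ TwoSidedIdeal.ker (bandHom hb.cyclicallyComposable J) := by
    obtain ⟨S, -, hS⟩ := hI.generated
    have hmem : ∀ p ∈ S, ofArrow k p.1 * ofArrow k p.2 ∈ I := fun p hp => by
      rw [hS]; exact TwoSidedIdeal.subset_span ⟨p, hp, rfl⟩
    refine hS.le.trans (TwoSidedIdeal.span_le.2 ?_)
    rintro _ ⟨p, hp, rfl⟩
    rw [SetLike.mem_coe, TwoSidedIdeal.mem_ker]
    change MulOpposite.op (bandLin b J (ofArrow k p.1 * ofArrow k p.2)) = 0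
    rw [bandLin_mul hb.cyclicallyComposable, bandLin_ofArrow hb.cyclicallyComposable,
      bandLin_ofArrow hb.cyclicallyComposable]
    exact congrArg MulOpposite.op (bandArrow_comp_bandArrow_of_mem hb J _ _ (hmem p hp))
  intro x y hxy
  rw [RingCon.ker_apply]
  have := (TwoSidedIdeal.mem_ker _).1 (hle ((TwoSidedIdeal.rel_iff I x y).1 hxy))
  rwa [map_sub, sub_eq_zero] at this

/-- The right action of `A = kQ / I` on the band space of the band `b`, with the invertible
matrix `J` attached to the last letter. -/
def bandAction {I : TwoSidedIdeal (PathAlgebra k V)} (hI : IsGentlePair I)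
    {b : List (Letter V)} (hb : IsBand I b) {n : ℕ} (J : Matrix (Fin n) (Fin n) k) :
    BoundAlgebra I →+* (Module.End k (BandSpace k b n))ᵐᵒᵖ :=
  RingCon.lift I.ringCon (bandHom hb.cyclicallyComposable J) (bandHom_ker hI hb J)

/-- The space of the band module, as a right `A`-module, i.e. as a module over `Aᵐᵒᵖ`. -/
@[reducible]
def bandModuleStr {I : TwoSidedIdeal (PathAlgebra k V)} (hI : IsGentlePair I)
    {b : List (Letter V)} (hb : IsBand I b) {n : ℕ} (J : Matrix (Fin n) (Fin n) k) :
    Module (BoundAlgebra I)ᵐᵒᵖ (BandSpace k b n) :=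
  Module.compHom (BandSpace k b n)
    ((RingEquiv.opOp (Module.End k (BandSpace k b n))).symm.toRingHom.comp
      (RingHom.op (bandAction hI hb J)))

/-- The band module `B(n, l)` of the band `b`: the right `A`-module given by `b` and the Jordan
block of size `n` with eigenvalue `l`. -/
def bandModule {I : TwoSidedIdeal (PathAlgebra k V)} (hI : IsGentlePair I)
    {b : List (Letter V)} (hb : IsBand I b) (n : ℕ) (l : k) :
    ModuleCat.{u} (BoundAlgebra I)ᵐᵒᵖ :=
  letI := bandModuleStr hI hb (jordanBlock n l)
  ModuleCat.of (BoundAlgebra I)ᵐᵒᵖ (BandSpace k b n)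

end Rep

end GentleAlg

end

noncomputable section

namespace GentleAlg

/-! ## Modules of projective or injective dimension one -/

section Homological

/-! The band itself writes down a presentation of its module. Regard right `A`-modules as left
modules over `R = Aᵐᵒᵖ`. Take `n` generators at each position of the cyclic word and `n` relations
for each letter: the arrow of the letter, applied to the generators at its source, equals an
invertible matrix applied to the generators at its target. This gives `diff : P₁ → P₀` with `P₀ = ⨁
(R e_{vert j})^n` over the positions and `P₁ = ⨁ (R e_{t (arr i)})^n` over the letters.

The cokernel is the band module because every element of `P₀` is congruent modulo the image to a
`k`-combination of generators (`IsReduced.mem_diffSupGen`). Indeed an arrow starting at a position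
is either one of the letters there, and can be traded for a matrix, or has zero product with a
letter ending there, and is then itself in the image (`IsReduced.exists_letter`). The map `diff` is
injective (`IsReduced.eq_zero_of_diff`) by propagating equations once around the word; this needs
letters of both directions, which nilpotency provides. So the projective dimension is at most one.

For the injective dimension, the same construction over `A`, with the reversed word and transposed
matrices, resolves the `k`-dual of the band module. Dualizing back gives a two-term coresolution,
whose terms are injective by `RightDual.baer`.

The lower bounds are local. At a position where two letters end, a nonzero vector is divisible by
two distinct arrows, which is impossible in a projective module (`eq_zero_of_projective`). At a
position where two letters start, an injective module would contain a vector seen by one arrow and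
killed by the other (`exists_smul_eq_of_baer`), but both arrows act there by invertible matrices.

All this uses only the axioms of `IsGentleSystem`, which is why `A` and its opposite can be treated
together. They are checked for gentle algebras through `IsGentlePair.mem_iff`: the classes of the
paths without relations form a basis of `A`. -/

/-- A module with a two-term projective resolution, whose terms may live in other universes. -/
theorem hasProjectiveDimensionLE_one_of_exact {R : Type w} [Ring R] {M : ModuleCat.{u} R}
    {P Q : Type*} [AddCommGroup P] [Module R P] [AddCommGroup Q] [Module R Q]
    [Small.{u} P] [Small.{u} Q] [Module.Projective R P] [Module.Projective R Q]
    (d : P →ₗ[R] Q) (π : Q →ₗ[R] M) (hd : Function.Injective d) (hex : Function.Exact d π)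
    (hπ : Function.Surjective π) : HasProjectiveDimensionLE M 1 := by
  let eP := Shrink.linearEquiv.{u} R P
  let eQ := Shrink.linearEquiv.{u} R Q
  have : Module.Projective R (Shrink.{u} P) := Module.Projective.of_equiv eP.symm
  have : Module.Projective R (Shrink.{u} Q) := Module.Projective.of_equiv eQ.symm
  let f : ModuleCat.of R (Shrink.{u} P) ⟶ ModuleCat.of R (Shrink.{u} Q) :=
    ModuleCat.ofHom (eQ.symm.toLinearMap ∘ₗ d ∘ₗ eP.toLinearMap)
  let g : ModuleCat.of R (Shrink.{u} Q) ⟶ M := ModuleCat.ofHom (π ∘ₗ eQ.toLinearMap)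
  have hfg : Function.Exact f g := fun y => by
    change π (eQ y) = 0 ↔ ∃ x, eQ.symm (d (eP x)) = y
    rw [hex (eQ y)]
    constructor
    · rintro ⟨x, hx⟩
      exact ⟨eP.symm x, by rw [eP.apply_symm_apply, hx, eQ.symm_apply_apply]⟩
    · rintro ⟨x, rfl⟩
      exact ⟨eP x, by rw [eQ.apply_symm_apply]⟩
  let S : ShortComplex (ModuleCat.{u} R) :=
    ShortComplex.mk f g (ModuleCat.hom_ext (LinearMap.ext hfg.apply_apply_eq_zero))
  have hS : S.ShortExact := ModuleCat.shortComplex_shortExact S hfg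
    (eQ.symm.injective.comp (hd.comp eP.injective)) (hπ.comp eQ.surjective)
  have h1 : Projective S.X₁ := ModuleCat.projective_of_categoryTheory_projective _
  have h2 : Projective S.X₂ := ModuleCat.projective_of_categoryTheory_projective _
  exact hS.hasProjectiveDimensionLT_X₃ 1 inferInstance inferInstance

/-- A module with a two-term injective resolution, whose terms may live in other universes. -/
theorem hasInjectiveDimensionLE_one_of_exact {R : Type w} [Ring R] {M : ModuleCat.{u} R}
    {P Q : Type*} [AddCommGroup P] [Module R P] [AddCommGroup Q] [Module R Q]
    [Small.{u} P] [Small.{u} Q] (hP : Module.Baer R P) (hQ : Module.Baer R Q)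
    (ι : M →ₗ[R] P) (d : P →ₗ[R] Q) (hι : Function.Injective ι) (hex : Function.Exact ι d)
    (hd : Function.Surjective d) : HasInjectiveDimensionLE M 1 := by
  let eP := Shrink.linearEquiv.{u} R P
  let eQ := Shrink.linearEquiv.{u} R Q
  have : Module.Injective R (Shrink.{u} P) := (hP.of_equiv eP.symm).injective
  have : Module.Injective R (Shrink.{u} Q) := (hQ.of_equiv eQ.symm).injective
  let f : M ⟶ ModuleCat.of R (Shrink.{u} P) := ModuleCat.ofHom (eP.symm.toLinearMap ∘ₗ ι)
  let g : ModuleCat.of R (Shrink.{u} P) ⟶ ModuleCat.of R (Shrink.{u} Q) :=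
    ModuleCat.ofHom (eQ.symm.toLinearMap ∘ₗ d ∘ₗ eP.toLinearMap)
  have hfg : Function.Exact f g := fun y => by
    change eQ.symm (d (eP y)) = 0 ↔ ∃ x, eP.symm (ι x) = y
    rw [LinearEquiv.map_eq_zero_iff, hex (eP y)]
    exact exists_congr fun x => (LinearEquiv.symm_apply_eq eP).symm
  let S : ShortComplex (ModuleCat.{u} R) :=
    ShortComplex.mk f g (ModuleCat.hom_ext (LinearMap.ext hfg.apply_apply_eq_zero))
  have hS : S.ShortExact := ModuleCat.shortComplex_shortExact S hfg
    (eP.symm.injective.comp hι) (eQ.symm.surjective.comp (hd.comp eP.surjective))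
  have h2 : Injective S.X₂ := Module.injective_object_of_injective_module R (Shrink.{u} P)
  have h3 : Injective S.X₃ := Module.injective_object_of_injective_module R (Shrink.{u} Q)
  exact hS.hasInjectiveDimensionLT_X₁ 1 inferInstance inferInstance

/-- If `a ∈ R` and `c ∈ R` generate independent right ideals, then no nonzero element of a projective
module is divisible by both. -/
theorem eq_zero_of_projective {R M : Type*} [Ring R] [AddCommGroup M] [Module R M]
    [Module.Projective R M] {a c : R} (hac : ∀ r r' : R, a * r = c * r' → a * r = 0)
    {y z : M} (h : a • y = c • z) : a • y = 0 := by
  obtain ⟨s, hs⟩ := Module.projective_def'.1 (‹Module.Projective R M›)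
  -- The section `s` embeds the module in a free one, where each coordinate gives an equation `a * r
  -- = c * r'` in `R`.
  have h0 : s (a • y) = 0 := by
    ext t
    have := DFunLike.congr_fun (congrArg s h) t
    rw [map_smul, map_smul, Finsupp.smul_apply, Finsupp.smul_apply] at this
    rw [map_smul, Finsupp.smul_apply]
    exact hac _ _ this
  have := LinearMap.congr_fun hs (a • y)
  rw [LinearMap.comp_apply, h0, map_zero] at this
  exact this.symm

/-- If `a ∈ R` and `c ∈ R` generate independent left ideals, then in an injective module an element
of the form `a y` is also of the form `a y'` with `c y' = 0`. -/
theorem exists_smul_eq_of_baer {R M : Type*} [Ring R] [AddCommGroup M] [Module R M]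
    (hM : Module.Baer R M) {a c : R} (hac : ∀ r r' : R, r * a + r' * c = 0 → r * a = 0) (y : M) :
    ∃ y' : M, a • y' = a • y ∧ c • y' = 0 := by
  let f : R × R →ₗ[R] R := (LinearMap.toSpanSingleton R R a).coprod
    (LinearMap.toSpanSingleton R R c)
  let φ : R × R →ₗ[R] M := (LinearMap.toSpanSingleton R M (a • y)) ∘ₗ LinearMap.fst R R R
  have hle : LinearMap.ker f ≤ LinearMap.ker φ := by
    rintro ⟨r, r'⟩ h
    have h' : r * a + r' * c = 0 := h
    change r • a • y = 0
    rw [smul_smul, hac r r' h', zero_smul]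
  -- On the left ideal `R a + R c` this is `r a + r' c ↦ r a y`, well defined by independence. If
  -- `g'` extends it to `R`, then `g' 1` is the element sought.
  let g : LinearMap.range f →ₗ[R] M :=
    (LinearMap.ker f).liftQ φ hle ∘ₗ f.quotKerEquivRange.symm.toLinearMap
  have hg : ∀ p, g ⟨f p, p, rfl⟩ = φ p := fun p => by
    have : f.quotKerEquivRange.symm ⟨f p, p, rfl⟩ = (LinearMap.ker f).mkQ p := by
      rw [LinearEquiv.symm_apply_eq]; rfl
    change (LinearMap.ker f).liftQ φ hle (f.quotKerEquivRange.symm ⟨f p, p, rfl⟩) = φ p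
    rw [this]; exact Submodule.liftQ_apply _ _ _
  obtain ⟨g', hg'⟩ := hM (LinearMap.range f) g
  have key : ∀ p : R × R, f p • g' 1 = p.1 • a • y := fun p => by
    rw [← map_smul, smul_eq_mul, mul_one, hg' (f p) ⟨p, rfl⟩, hg p]
    rfl
  refine ⟨g' 1, ?_, ?_⟩
  · have := key (1, 0)
    simpa [f] using this
  · have := key (0, 1)
    simpa [f] using this

/-- The `k`-dual of a left `R`-module, as a right `R`-module. -/
def RightDual (k : Type*) (R : Type*) (Q : Type*) [Field k] [Ring R] [AddCommGroup Q] [Module k Q] :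
    Type _ := Q →ₗ[k] k

/-! ### Duals of projective left modules are injective right modules -/

section RightDual

variable (k : Type*) (R : Type*) (Q : Type*) [Field k] [Ring R] [AddCommGroup Q] [Module k Q]

instance : AddCommGroup (RightDual k R Q) := inferInstanceAs (AddCommGroup (Q →ₗ[k] k))

instance : FunLike (RightDual k R Q) Q k := inferInstanceAs (FunLike (Q →ₗ[k] k) Q k)

instance : LinearMapClass (RightDual k R Q) k Q k :=
  inferInstanceAs (LinearMapClass (Q →ₗ[k] k) k Q k)

variable {k R Q} in
theorem RightDual.ext {φ ψ : RightDual k R Q} (h : ∀ q, φ q = ψ q) : φ = ψ := LinearMap.ext h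

variable [Algebra k R] [Module R Q] [IsScalarTower k R Q]

instance : Module Rᵐᵒᵖ (RightDual k R Q) where
  smul a φ := LinearMap.comp (show Q →ₗ[k] k from φ) (Algebra.lsmul k k Q a.unop)
  one_smul φ := LinearMap.ext fun q => congrArg φ (one_smul R q)
  mul_smul a b φ := LinearMap.ext fun q => congrArg φ (mul_smul b.unop a.unop q)
  smul_zero _ := LinearMap.zero_comp _
  smul_add _ _ _ := LinearMap.add_comp _ _ _
  add_smul a b φ := LinearMap.ext fun q =>
    (congrArg φ (add_smul a.unop b.unop q)).trans (map_add φ _ _)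
  zero_smul φ := LinearMap.ext fun q => (congrArg φ (zero_smul R q)).trans (map_zero φ)

variable {k R Q}

theorem RightDual.smul_apply (a : Rᵐᵒᵖ) (φ : RightDual k R Q) (q : Q) :
    (a • φ) q = φ (a.unop • q) := rfl

variable (k R Q) in
/-- The dual of a projective left module satisfies Baer's criterion. -/
theorem RightDual.baer [Module.Projective R Q] : Module.Baer Rᵐᵒᵖ (RightDual k R Q) := by
  intro I g
  obtain ⟨s, hs⟩ := Module.projective_def'.1 (‹Module.Projective R Q›)
  let J : Submodule k R :=
    { carrier := {a | MulOpposite.op a ∈ I}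
      add_mem' := fun ha hb => I.add_mem ha hb
      zero_mem' := I.zero_mem
      smul_mem' := fun c a ha => by
        have := I.mul_mem_left (MulOpposite.op (algebraMap k R c)) ha
        rwa [← MulOpposite.op_mul, ← Algebra.commutes, ← Algebra.smul_def] at this }
  let g₀ : J →ₗ[k] (Q →ₗ[k] k) :=
    { toFun := fun a => g ⟨MulOpposite.op a.1, a.2⟩
      map_add' := fun a b => map_add g ⟨MulOpposite.op a.1, a.2⟩ ⟨MulOpposite.op b.1, b.2⟩
      map_smul' := fun c a => by
        refine LinearMap.ext fun q => ?_
        have : (⟨MulOpposite.op (c • a).1, (c • a).2⟩ : I) =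
            MulOpposite.op (algebraMap k R c) • ⟨MulOpposite.op a.1, a.2⟩ := by
          refine Subtype.ext ?_
          change MulOpposite.op (c • a.1) = MulOpposite.op (algebraMap k R c) * MulOpposite.op a.1
          rw [← MulOpposite.op_mul, ← Algebra.commutes, ← Algebra.smul_def]
        rw [this, map_smul]
        change g _ (algebraMap k R c • q) = c • g _ q
        rw [algebraMap_smul, map_smul] }
  -- The extension `G` is only `k`-linear. The functional `φ` below evaluates `G` on the
  -- coefficients supplied by the section `s`: if `s q = ∑ r_c • [c]`, then `φ q = ∑ G r_c c`.
  -- Multiplying by `a ∈ I` moves all coefficients into the ideal, where `G` agrees with the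
  -- `R`-linear `g`.
  obtain ⟨G, hG⟩ := LinearMap.exists_extend g₀
  have hG' : ∀ (a : R) (ha : MulOpposite.op a ∈ I) (q : Q), G a q = g ⟨MulOpposite.op a, ha⟩ q :=
    fun a ha q => LinearMap.congr_fun (LinearMap.congr_fun hG ⟨a, ha⟩) q
  let ψ : (Q →₀ R) →ₗ[k] k := Finsupp.lsum k fun q => G.flip q
  let φ : RightDual k R Q := ψ ∘ₗ s.restrictScalars k
  refine ⟨LinearMap.toSpanSingleton _ _ φ, fun a ha => RightDual.ext fun q => ?_⟩
  rw [LinearMap.toSpanSingleton_apply, RightDual.smul_apply]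
  change ψ (s (a.unop • q)) = _
  rw [map_smul]
  have h1 : ∀ t : Q →₀ R, ψ (a.unop • t) = g ⟨a, ha⟩ (Finsupp.linearCombination R id t) := by
    intro t
    induction t using Finsupp.induction_linear with
    | zero => simp
    | add x y hx hy => rw [smul_add, map_add, hx, hy, map_add, map_add]
    | single c r =>
      rw [Finsupp.smul_single, Finsupp.linearCombination_single]
      change Finsupp.lsum k (fun q => G.flip q) (Finsupp.single c (a.unop * r)) = g ⟨a, ha⟩ (r • c)
      rw [Finsupp.lsum_single, LinearMap.flip_apply,
        hG' (a.unop * r) (by exact I.mul_mem_left (MulOpposite.op r) ha), ← MulOpposite.unop_op r,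
        ← RightDual.smul_apply, ← map_smul]
      rfl
  rw [h1]
  exact congrArg (g ⟨a, ha⟩) (LinearMap.congr_fun hs q)

end RightDual

end Homological

/-! ## Gentle systems -/

/-- A ring with idempotents `e v` and elements `x a = e (t a) * x a * e (s a)` that behave like the
trivial paths and the arrows of a gentle algebra; products are composed like functions. The axioms
are those on arrows with a common target, so that gentle algebras and their opposites are covered. -/
structure IsGentleSystem (k : Type*) {R V E : Type*} [Field k] [Ring R] [Algebra k R]
    (s t : E → V) (e : V → R) (x : E → R) : Prop where
  e_mul_e : ∀ v, e v * e v = e v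
  e_mul_e_of_ne : ∀ v v', v ≠ v' → e v * e v' = 0
  e_mul_x : ∀ a, e (t a) * x a = x a
  x_mul_e : ∀ a, x a * e (s a) = x a
  x_mul_e_of_ne : ∀ a v, s a ≠ v → x a * e v = 0
  adjoin_eq_top : Algebra.adjoin k (Set.range e ∪ Set.range x) = ⊤
  nilpotent : ∃ N, ∀ l : List E, N ≤ l.length → (l.map x).prod = 0
  src_le_two : ∀ a b c, s a = s b → s b = s c → a = b ∨ b = c ∨ a = c
  mul_eq_zero_of_ne : ∀ a b b', s b = t a → s b' = t a → x b * x a ≠ 0 → b' ≠ b → x b' * x a = 0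
  mul_eq_zero_or : ∀ a a' b, t a = s b → t a' = s b → a ≠ a' → x b * x a = 0 ∨ x b * x a' = 0
  mul_x_eq_zero : ∀ a a' r r', a ≠ a' → r * x a + r' * x a' = 0 → r * x a = 0
  mul_x_cancel : ∀ a b r, x b * x a ≠ 0 → r * x b * x a = 0 → r * x b = 0
  eq_zero_of_mul_x : ∀ a a' r, a ≠ a' → t a = t a' → r * e (t a) = r → r * x a = 0 →
    r * x a' = 0 → r = 0

/-- In a gentle system, there is no infinite sequence of arrows with nonzero products. -/
theorem IsGentleSystem.not_forall_mul_ne_zero {k R V E ι : Type*} [Field k] [Ring R] [Algebra k R]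
    {s t : E → V} {e : V → R} {x : E → R} (h : IsGentleSystem k s t e x) (arr : ι → E) (g : ι → ι)
    (i : ι) : ¬ ∀ i, x (arr (g i)) * x (arr i) ≠ 0 := by
  intro hne
  -- The last factor `x (arr i)` is kept separate so that `mul_x_cancel` applies when an arrow is
  -- appended on the right.
  have key : ∀ (N : ℕ) (i : ι), ∃ l : List E, N ≤ l.length ∧ ∃ r : R,
      (l.map x).prod = r * x (arr i) ∧ r * x (arr i) ≠ 0 := by
    intro N
    induction N with
    | zero =>
      exact fun i => ⟨[arr i], Nat.zero_le _, 1, by simp, fun h0 => hne i (by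
        rw [one_mul] at h0; rw [h0, mul_zero])⟩
    | succ N ih =>
      intro i
      obtain ⟨l, hl, r, hr, hr0⟩ := ih (g i)
      refine ⟨l ++ [arr i], by simpa using hl, r * x (arr (g i)), by simp [hr], fun h0 => hr0 ?_⟩
      exact h.mul_x_cancel _ _ _ (hne i) h0
  obtain ⟨N, hN⟩ := h.nilpotent
  obtain ⟨l, hl, r, hr, hr0⟩ := key N i
  exact hr0 (hr.symm.trans (hN l hl))

/-! ## Cyclic words -/

/-- A cyclic sequence of positions `i : ι`, with letters between `i` and `nxt i`; the letter at `i`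
is given by an arrow `arr i` and its direction. -/
structure CyclicWord (ι V E : Type*) where
  /-- the next position -/
  nxt : Equiv.Perm ι
  /-- whether the letter is an arrow (and not the inverse of an arrow) -/
  dir : ι → Bool
  /-- the arrow of the letter -/
  arr : ι → E
  /-- the vertex of the position -/
  vert : ι → V

namespace CyclicWord

variable {k ι R V E : Type*} [Field k] [Ring R] [Algebra k R]

/-- The position at the source of the arrow of the letter at `i`. -/
def src (c : CyclicWord ι V E) (i : ι) : ι := if c.dir i then i else c.nxt i

/-- The position at the target of the arrow of the letter at `i`. -/
def tgt (c : CyclicWord ι V E) (i : ι) : ι := if c.dir i then c.nxt i else i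

/-- The word with all arrows reversed. -/
def reverse (c : CyclicWord ι V E) : CyclicWord ι V E := { c with dir := fun i => !c.dir i }

theorem reverse_src (c : CyclicWord ι V E) (i : ι) : c.reverse.src i = c.tgt i := by
  cases h : c.dir i <;> simp [src, tgt, reverse, h]

theorem reverse_tgt (c : CyclicWord ι V E) (i : ι) : c.reverse.tgt i = c.src i := by
  cases h : c.dir i <;> simp [src, tgt, reverse, h]

/-- Cyclic words without relations and backtracking. -/
structure IsReduced (c : CyclicWord ι V E) (s t : E → V) (x : E → R) : Prop where
  vert_src : ∀ i, c.vert (c.src i) = s (c.arr i)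
  vert_tgt : ∀ i, c.vert (c.tgt i) = t (c.arr i)
  mul_ne_zero : ∀ i, c.dir i = true → c.dir (c.nxt i) = true →
    x (c.arr (c.nxt i)) * x (c.arr i) ≠ 0
  mul_ne_zero' : ∀ i, c.dir i = false → c.dir (c.nxt i) = false →
    x (c.arr i) * x (c.arr (c.nxt i)) ≠ 0
  arr_ne : ∀ i, c.dir i ≠ c.dir (c.nxt i) → c.arr i ≠ c.arr (c.nxt i)
  cyclic : ∀ p : ι → Prop, (∀ i, p i → p (c.nxt i)) → ∀ i j, p i → p j

section

variable {s t : E → V} {e : V → R} {x : E → R} {c : CyclicWord ι V E}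

/-- Otherwise the word is an oriented cycle without relations, and running around it yields
arbitrarily long nonzero products. -/
theorem IsReduced.exists_dir_eq_false (hc : c.IsReduced s t x) (h : IsGentleSystem k s t e x)
    [hι : Nonempty ι] : ∃ i, c.dir i = false := by
  by_contra! hn
  simp only [ne_eq, Bool.not_eq_false] at hn
  exact h.not_forall_mul_ne_zero c.arr c.nxt hι.some fun i => hc.mul_ne_zero i (hn i) (hn _)

theorem IsReduced.exists_dir_eq_true (hc : c.IsReduced s t x) (h : IsGentleSystem k s t e x)
    [hι : Nonempty ι] : ∃ i, c.dir i = true := by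
  by_contra! hn
  simp only [ne_eq, Bool.not_eq_true] at hn
  exact h.not_forall_mul_ne_zero c.arr c.nxt.symm hι.some fun i => by
    simpa using hc.mul_ne_zero' (c.nxt.symm i) (hn _) (hn _)

/-- If every direct letter were followed by a direct one, all letters would be direct. The position
found is the target of both letters; for the reversed word it is the source of both. These are the
positions that obstruct projectivity and injectivity. -/
theorem IsReduced.exists_true_false (hc : c.IsReduced s t x) (h : IsGentleSystem k s t e x)
    [hι : Nonempty ι] : ∃ i, c.dir i = true ∧ c.dir (c.nxt i) = false := by
  by_contra! hn
  obtain ⟨i, hi⟩ := hc.exists_dir_eq_true h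
  obtain ⟨j, hj⟩ := hc.exists_dir_eq_false h
  have := hc.cyclic (fun i => c.dir i = true) (fun i hi => by simpa using hn i hi) i j hi
  simp [hj] at this

/-- Every arrow that starts at a position either is a letter starting there, or has a relation with
a letter ending there. -/
theorem IsReduced.exists_letter (hc : c.IsReduced s t x) (h : IsGentleSystem k s t e x) (j : ι)
    (a : E) (ha : s a = c.vert j) :
    (∃ i, c.src i = j ∧ c.arr i = a) ∨ ∃ i, c.tgt i = j ∧ x a * x (c.arr i) = 0 := by
  obtain ⟨p, rfl⟩ := c.nxt.surjective j
  by_contra! hn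
  obtain ⟨hn1, hn2⟩ := hn
  have hs1 := hc.vert_src p
  have hs2 := hc.vert_src (c.nxt p)
  have ht1 := hc.vert_tgt p
  have ht2 := hc.vert_tgt (c.nxt p)
  have hne := hc.arr_ne p
  have hm := hc.mul_ne_zero p
  have hm' := hc.mul_ne_zero' p
  have h11 := hn1 p
  have h12 := hn1 (c.nxt p)
  have h21 := hn2 p
  have h22 := hn2 (c.nxt p)
  -- The position lies between the letters `p` and `nxt p`. If the word passes through it in one
  -- direction, one arrow `b` leaves it and one enters with nonzero product, so any `a ≠ b` has zero
  -- product with the entering one. If both letters leave, they exhaust the arrows starting there.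
  -- If both enter, `a` can have nonzero product with at most one of them.
  cases h1 : c.dir p <;> cases h2 : c.dir (c.nxt p) <;>
    simp only [src, tgt, h1, h2, if_true, if_false, Bool.false_eq_true, ne_eq,
      not_false_eq_true, forall_const, not_true_eq_false, reduceCtorEq] at *
  · exact h22 (h.mul_eq_zero_of_ne _ _ _ (hs1.symm.trans ht2) (ha.trans ht2) hm' (Ne.symm h11))
  · rcases h.src_le_two (c.arr p) (c.arr (c.nxt p)) a (hs1.symm.trans hs2) (hs2.symm.trans ha.symm)
      with h0 | h0 | h0
    exacts [hne h0, h12 h0, h11 h0]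
  · rcases h.mul_eq_zero_or (c.arr p) (c.arr (c.nxt p)) a (ht1.symm.trans ha.symm)
      (ht2.symm.trans ha.symm) hne with h0 | h0
    exacts [h21 h0, h22 h0]
  · exact h21 (h.mul_eq_zero_of_ne _ _ _ (hs2.symm.trans ht1) (ha.trans ht1) hm (Ne.symm h12))

end

/-! ### The differential -/

section Differential

variable {n : ℕ}

/-- Right multiplication of row vectors by a ring element. -/
def rightMul (n : ℕ) (a : R) : (Fin n → R) →ₗ[R] (Fin n → R) :=
  LinearMap.pi fun r => LinearMap.toSpanSingleton R R a ∘ₗ LinearMap.proj r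

theorem rightMul_apply (a : R) (w : Fin n → R) (r : Fin n) : rightMul n a w r = w r * a := rfl

variable (R) in
/-- The action of a matrix with coefficients in `k`. -/
def matAct (F : Matrix (Fin n) (Fin n) k) : (Fin n → R) →ₗ[R] (Fin n → R) :=
  LinearMap.pi fun r => ∑ l, F r l • LinearMap.proj l

theorem matAct_apply (F : Matrix (Fin n) (Fin n) k) (w : Fin n → R) (r : Fin n) :
    matAct R F w r = ∑ l, F r l • w l := by
  simp [matAct]

theorem matAct_matAct (F G : Matrix (Fin n) (Fin n) k) (w : Fin n → R) :
    matAct R F (matAct R G w) = matAct R (F * G) w := by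
  ext r
  simp only [matAct_apply, Matrix.mul_apply, Finset.smul_sum, Finset.sum_smul, smul_smul]
  exact Finset.sum_comm

theorem matAct_one (w : Fin n → R) : matAct R (1 : Matrix (Fin n) (Fin n) k) w = w := by
  ext r
  simp [matAct_apply, Matrix.one_apply]

theorem matAct_inv {F : Matrix (Fin n) (Fin n) k} (hF : IsUnit F) (w : Fin n → R) :
    matAct R F (matAct R F⁻¹ w) = w := by
  rw [matAct_matAct, Matrix.mul_nonsing_inv F ((Matrix.isUnit_iff_isUnit_det F).1 hF), matAct_one]

theorem inv_matAct {F : Matrix (Fin n) (Fin n) k} (hF : IsUnit F) (w : Fin n → R) :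
    matAct R F⁻¹ (matAct R F w) = w := by
  rw [matAct_matAct, Matrix.nonsing_inv_mul F ((Matrix.isUnit_iff_isUnit_det F).1 hF), matAct_one]

theorem eq_zero_of_matAct {F : Matrix (Fin n) (Fin n) k} (hF : IsUnit F) {w : Fin n → R}
    (h : matAct R F w = 0) : w = 0 := by
  rw [← inv_matAct hF w, h, map_zero]

theorem rightMul_matAct (F : Matrix (Fin n) (Fin n) k) (a : R) (w : Fin n → R) :
    rightMul n a (matAct R F w) = matAct R F (rightMul n a w) := by
  ext r
  simp [matAct_apply, rightMul_apply, Finset.sum_mul]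

variable (c : CyclicWord ι V E) (x : E → R) (F : ι → Matrix (Fin n) (Fin n) k)

/-- The component at the position `i` of the differential of the letter at `i`. -/
def outMap (i : ι) : (Fin n → R) →ₗ[R] (Fin n → R) :=
  if c.dir i then rightMul n (x (c.arr i)) else -matAct R (F i)

/-- The component at the position `nxt i` of the differential of the letter at `i`. -/
def inMap (i : ι) : (Fin n → R) →ₗ[R] (Fin n → R) :=
  if c.dir i then -matAct R (F i) else rightMul n (x (c.arr i))

/-- The differential, from the free module on the letters to the free module on the positions. -/
def diff : (ι → Fin n → R) →ₗ[R] (ι → Fin n → R) :=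
  LinearMap.pi fun j => c.outMap x F j ∘ₗ LinearMap.proj j +
    c.inMap x F (c.nxt.symm j) ∘ₗ LinearMap.proj (c.nxt.symm j)

theorem diff_apply (w : ι → Fin n → R) (j : ι) : c.diff x F w j =
    c.outMap x F j (w j) + c.inMap x F (c.nxt.symm j) (w (c.nxt.symm j)) := rfl

/-- In terms of sources and targets the two directions of a letter need no distinction. This form
serves for the cokernel, while the coordinates of `diff_apply` serve for injectivity. -/
theorem diff_single [DecidableEq ι] (i : ι) (w : Fin n → R) :
    c.diff x F (Pi.single i w) =
      Pi.single (c.src i) (rightMul n (x (c.arr i)) w) -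
        Pi.single (c.tgt i) (matAct R (F i) w) := by
  have h : c.diff x F (Pi.single i w) =
      Pi.single i (c.outMap x F i w) + Pi.single (c.nxt i) (c.inMap x F i w) := by
    funext j
    rw [diff_apply, Pi.add_apply]
    congr 1
    · by_cases hj : j = i
      · subst hj; simp
      · simp [hj]
    · obtain ⟨p, rfl⟩ := c.nxt.surjective j
      by_cases hp : p = i
      · subst hp; simp
      · simp [hp]
  rw [h]
  cases hi : c.dir i
  · simp only [outMap, inMap, src, tgt, hi, if_false, Bool.false_eq_true, LinearMap.neg_apply]
    rw [Pi.single_neg (f := fun _ => Fin n → R), neg_add_eq_sub]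
  · simp only [outMap, inMap, src, tgt, hi, if_true, LinearMap.neg_apply]
    rw [Pi.single_neg (f := fun _ => Fin n → R), ← sub_eq_add_neg]

variable {c x F} {s t : E → V} {e : V → R}

/-- Each position gives one equation linking the two adjacent letters. Propagating along the word
shows first that `w i * x (arr i) = 0` for every letter; the equations then involve only the
invertible matrices, and `w` vanishes. -/
theorem IsReduced.eq_zero_of_diff (hc : c.IsReduced s t x) (h : IsGentleSystem k s t e x)
    (hF : ∀ i, IsUnit (F i)) [Nonempty ι] (w : ι → Fin n → R)
    (hw : ∀ i r, w i r * e (t (c.arr i)) = w i r) (hd : c.diff x F w = 0) : w = 0 := by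
  have hpos : ∀ i, c.outMap x F (c.nxt i) (w (c.nxt i)) + c.inMap x F i (w i) = 0 := fun i => by
    have := congrFun hd (c.nxt i)
    rwa [diff_apply, Equiv.symm_apply_apply] at this
  obtain ⟨i₀, hi₀⟩ := hc.exists_dir_eq_false h
  obtain ⟨i₁, hi₁⟩ := hc.exists_dir_eq_true h
  -- Induction around the word, vacuous at the inverse letter `i₀`. After an inverse letter, both
  -- terms are left multiples of distinct arrows and vanish separately. After a direct letter,
  -- multiplying the equation by its arrow kills the matrix term, and `mul_x_cancel` applies.
  have hdir : ∀ i, c.dir i = true → rightMul n (x (c.arr i)) (w i) = 0 := by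
    intro i
    refine hc.cyclic (fun i => c.dir i = true → rightMul n (x (c.arr i)) (w i) = 0) ?_ i₀ i
      (by simp [hi₀])
    intro i hi hi'
    have hp := hpos i
    cases hdi : c.dir i
    · simp only [outMap, inMap, hi', hdi, if_true, if_false, Bool.false_eq_true] at hp
      funext r
      exact h.mul_x_eq_zero _ _ _ _ (hc.arr_ne i (by simp [hi', hdi])).symm (congrFun hp r)
    · simp only [outMap, inMap, hi', hdi, if_true, LinearMap.neg_apply] at hp
      have hp' := eq_of_sub_eq_zero ((sub_eq_add_neg _ _).trans hp)
      have h0 := congrArg (rightMul n (x (c.arr i))) hp'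
      rw [rightMul_matAct, hi hdi, map_zero] at h0
      funext r
      exact h.mul_x_cancel _ _ _ (hc.mul_ne_zero i hdi hi') (congrFun h0 r)
  -- Here it is the failure that propagates forward: after a bad inverse letter comes another one,
  -- so the direct letter `i₁` is never reached.
  have hinv : ∀ i, c.dir i = false → rightMul n (x (c.arr i)) (w i) = 0 := by
    by_contra! hn
    obtain ⟨i, hi⟩ := hn
    refine (hc.cyclic (fun i => c.dir i = false ∧ rightMul n (x (c.arr i)) (w i) ≠ 0)
      ?_ i i₁ hi).1.symm.trans hi₁ |> Bool.false_ne_true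
    intro i ⟨hdi, hi⟩
    have hp := hpos i
    cases hi' : c.dir (c.nxt i)
    · refine ⟨rfl, fun h0 => hi ?_⟩
      simp only [outMap, inMap, hi', hdi, if_false, Bool.false_eq_true,
        LinearMap.neg_apply] at hp
      have hp' := eq_of_sub_eq_zero ((sub_eq_neg_add _ _).trans hp)
      have h1 := congrArg (rightMul n (x (c.arr (c.nxt i)))) hp'
      rw [rightMul_matAct, h0, map_zero] at h1
      funext r
      exact h.mul_x_cancel _ _ _ (hc.mul_ne_zero' i hdi hi') (congrFun h1 r)
    · exfalso
      simp only [outMap, inMap, hi', hdi, if_true, if_false, Bool.false_eq_true] at hp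
      refine hi (funext fun r => ?_)
      exact h.mul_x_eq_zero _ _ _ _ (hc.arr_ne i (by simp [hi', hdi]))
        (congrFun ((add_comm _ _).trans hp) r)
  have hall : ∀ i, rightMul n (x (c.arr i)) (w i) = 0 := fun i => by
    cases hi : c.dir i
    exacts [hinv i hi, hdir i hi]
  -- At the position `nxt i` only the letters ending there still contribute. If there is just one,
  -- invertibility suffices.
  have hz : ∀ i, (c.dir i = true → w i = 0) ∧ (c.dir (c.nxt i) = false → w (c.nxt i) = 0) := by
    intro i
    have hp := hpos i
    cases hdi : c.dir i <;> cases hi' : c.dir (c.nxt i) <;>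
      simp only [outMap, inMap, hi', hdi, if_true, if_false, Bool.false_eq_true,
        LinearMap.neg_apply, hall, zero_add, add_zero, neg_eq_zero] at hp
    · exact ⟨by simp, fun _ => eq_zero_of_matAct (hF _) hp⟩
    · simp
    · have ht : t (c.arr (c.nxt i)) = t (c.arr i) := by
        rw [← hc.vert_tgt, ← hc.vert_tgt]
        simp [tgt, hdi, hi']
      have h1 : matAct R (F i) (w i) = -matAct R (F (c.nxt i)) (w (c.nxt i)) :=
        (add_eq_zero_iff_eq_neg'.1 (by
          have := congrArg Neg.neg hp
          rwa [neg_add, neg_neg, neg_neg, neg_zero] at this))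
      -- Two letters end here. The common value, up to sign, is annihilated by both of their
      -- distinct arrows with the same target, so `eq_zero_of_mul_x` applies.
      have h2 : matAct R (F i) (w i) = 0 := by
        funext r
        refine h.eq_zero_of_mul_x (c.arr i) (c.arr (c.nxt i)) _
          (hc.arr_ne i (by simp [hi', hdi])) ht.symm ?_ ?_ ?_
        · have : rightMul n (e (t (c.arr i))) (w i) = w i := funext fun r => hw i r
          rw [← rightMul_apply, rightMul_matAct, this]
        · rw [← rightMul_apply, rightMul_matAct, hall, map_zero]; rfl
        · rw [← rightMul_apply, h1, map_neg, rightMul_matAct, hall, map_zero, neg_zero]; rfl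
      refine ⟨fun _ => eq_zero_of_matAct (hF _) h2, fun _ => eq_zero_of_matAct (hF (c.nxt i)) ?_⟩
      rw [h2] at h1
      exact neg_eq_zero.1 h1.symm
    · exact ⟨fun _ => eq_zero_of_matAct (hF _) hp, by simp⟩
  funext i
  cases hi : c.dir i
  · obtain ⟨p, rfl⟩ := c.nxt.surjective i
    exact (hz p).2 hi
  · exact (hz i).1 hi

variable (c e) in
/-- The element of the free module on the positions with coordinates in `k`. -/
def gen (z : ι → Fin n → k) : ι → Fin n → R := fun j r => z j r • e (c.vert j)

variable (k c x e F t) in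
/-- The sum of the range of the differential and the `k`-span of the generators. -/
def diffSupGen : Submodule k (ι → Fin n → R) where
  carrier := {u | ∃ (w : ι → Fin n → R) (z : ι → Fin n → k),
    (∀ i r, w i r * e (t (c.arr i)) = w i r) ∧ u = c.diff x F w + c.gen e z}
  zero_mem' := ⟨0, 0, by simp, by
    rw [map_zero, zero_add]; funext j r; simp [gen]⟩
  add_mem' := by
    rintro _ _ ⟨w, z, hw, rfl⟩ ⟨w', z', hw', rfl⟩
    refine ⟨w + w', z + z', fun i r => ?_, ?_⟩
    · simp only [Pi.add_apply, add_mul, hw, hw']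
    · have : c.gen e (z + z') = c.gen e z + c.gen e z' := by
        funext j r; simp [gen, add_smul]
      rw [map_add, this]; abel
  smul_mem' := by
    rintro b _ ⟨w, z, hw, rfl⟩
    refine ⟨b • w, b • z, fun i r => ?_, ?_⟩
    · simp only [Pi.smul_apply, smul_mul_assoc, hw]
    · have : c.gen e (b • z) = b • c.gen e z := by
        funext j r; simp [gen, mul_smul]
      rw [← algebraMap_smul R b w, map_smul, this, algebraMap_smul, smul_add]

/-- The image of the differential is stable under `R`, so stability under `a` has to be tested on
the generators only. -/
theorem smul_mem_diffSupGen (a : R) (ha : ∀ z : ι → Fin n → k,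
    a • c.gen e z ∈ c.diffSupGen k x F t e) {u : ι → Fin n → R}
    (hu : u ∈ c.diffSupGen k x F t e) : a • u ∈ c.diffSupGen k x F t e := by
  obtain ⟨w, z, hw, rfl⟩ := hu
  rw [smul_add, ← map_smul]
  refine Submodule.add_mem _ ⟨a • w, 0, fun i r => ?_, ?_⟩ (ha z)
  · simp only [Pi.smul_apply, smul_eq_mul, mul_assoc, hw]
  · have : c.gen e (0 : ι → Fin n → k) = 0 := by funext j r; simp [gen]
    rw [this, add_zero]

theorem gen_mem_diffSupGen (z : ι → Fin n → k) : c.gen e z ∈ c.diffSupGen k x F t e :=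
  ⟨0, z, by simp, by rw [map_zero, zero_add]⟩

theorem diff_mem_diffSupGen {w : ι → Fin n → R} (hw : ∀ i r, w i r * e (t (c.arr i)) = w i r) :
    c.diff x F w ∈ c.diffSupGen k x F t e :=
  ⟨w, 0, hw, by
    have : c.gen e (0 : ι → Fin n → k) = 0 := by funext j r; simp [gen]
    rw [this, add_zero]⟩

/-- The dichotomy of `exists_letter` decides. A letter `a` starting at `j` is replaced, modulo the
image, by its matrix at the target; in the other case the element lies in the image. -/
theorem IsReduced.single_mem_diffSupGen [DecidableEq ι] (hc : c.IsReduced s t x)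
    (h : IsGentleSystem k s t e x) (hF : ∀ i, IsUnit (F i)) (j : ι) (a : E)
    (ha : s a = c.vert j) (z : Fin n → k) :
    Pi.single j (fun r => z r • x a) ∈ c.diffSupGen k x F t e := by
  rcases hc.exists_letter h j a ha with ⟨i, rfl, rfl⟩ | ⟨i, rfl, h0⟩
  · have h1 := diff_single c x F i (fun r => z r • e (t (c.arr i)))
    have h2 : rightMul n (x (c.arr i)) (fun r => z r • e (t (c.arr i))) =
        fun r => z r • x (c.arr i) := by
      funext r
      rw [rightMul_apply, smul_mul_assoc, h.e_mul_x]
    rw [h2] at h1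
    rw [← sub_add_cancel (Pi.single (c.src i) _) (Pi.single (c.tgt i) (matAct R (F i) _)), ← h1]
    refine Submodule.add_mem _ (diff_mem_diffSupGen fun i' r => ?_) ?_
    · by_cases hi : i' = i
      · subst hi; simp [h.e_mul_e]
      · simp [hi]
    · have h3 : Pi.single (c.tgt i) (matAct R (F i) fun r => z r • e (t (c.arr i))) =
          c.gen e (Pi.single (c.tgt i) ((F i).mulVec z)) := by
        funext i' r
        by_cases hi : i' = c.tgt i
        · subst hi
          simp [gen, matAct_apply, Matrix.mulVec, dotProduct, hc.vert_tgt, Finset.sum_smul,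
            smul_smul]
        · simp [hi, gen]
      rw [h3]
      exact gen_mem_diffSupGen _
  -- With this preimage the term at the source of `i` vanishes, since `x a * x (arr i) = 0`, and the
  -- term at the target is the given element up to sign.
  · have h1 := diff_single c x F i (matAct R (F i)⁻¹ fun r => z r • x a)
    have h2 : rightMul n (x (c.arr i)) (fun r => z r • x a) = 0 := by
      funext r
      rw [rightMul_apply, smul_mul_assoc, h0, smul_zero]; rfl
    rw [matAct_inv (hF i), rightMul_matAct, h2, map_zero, Pi.single_zero, zero_sub] at h1
    rw [← neg_neg (Pi.single (c.tgt i) _), ← h1]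
    refine Submodule.neg_mem _ (diff_mem_diffSupGen fun i' r => ?_)
    by_cases hi : i' = i
    · subst hi
      have h3 : rightMul n (e (t (c.arr i'))) (fun r => z r • x a) = fun r => z r • x a := by
        funext r
        rw [rightMul_apply, smul_mul_assoc, ← hc.vert_tgt, ← ha, h.x_mul_e]
      rw [Pi.single_eq_same, ← rightMul_apply, rightMul_matAct, h3]
    · simp [hi]

/-- The ring elements that send all generators into `diffSupGen` form a subalgebra `T`, so only the
idempotents and the arrows have to be tested. As they generate `R`, so do the generators `P₀`. -/
theorem IsReduced.mem_diffSupGen [Fintype ι] (hc : c.IsReduced s t x)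
    (h : IsGentleSystem k s t e x) (hF : ∀ i, IsUnit (F i)) (u : ι → Fin n → R)
    (hu : ∀ j r, u j r * e (c.vert j) = u j r) : u ∈ c.diffSupGen k x F t e := by
  classical
  let T : Subalgebra k R :=
    { carrier := {a | ∀ z : ι → Fin n → k, a • c.gen e z ∈ c.diffSupGen k x F t e}
      mul_mem' := fun ha hb z => by
        rw [mul_smul]
        exact smul_mem_diffSupGen _ ha (hb z)
      add_mem' := fun ha hb z => by
        rw [add_smul]
        exact Submodule.add_mem _ (ha z) (hb z)
      algebraMap_mem' := fun b z => by
        rw [algebraMap_smul]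
        exact Submodule.smul_mem _ _ (gen_mem_diffSupGen z) }
  have hT : T = ⊤ := by
    rw [eq_top_iff, ← h.adjoin_eq_top, Algebra.adjoin_le_iff]
    rintro _ (⟨v, rfl⟩ | ⟨a, rfl⟩) z
    · have : e v • c.gen e z = c.gen e (fun j => if v = c.vert j then z j else 0) := by
        funext j r
        by_cases hv : v = c.vert j
        · subst hv; simp [gen, h.e_mul_e]
        · simp [gen, hv, h.e_mul_e_of_ne _ _ hv]
      rw [this]
      exact gen_mem_diffSupGen _
    · have : x a • c.gen e z =
          ∑ j, if s a = c.vert j then Pi.single j (fun r => z j r • x a) else 0 := by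
        funext j r
        rw [Finset.sum_apply, Finset.sum_apply, Finset.sum_eq_single j]
        · by_cases hv : s a = c.vert j
          · have hx : x a * e (c.vert j) = x a := hv ▸ h.x_mul_e a
            simp [gen, hv, hx]
          · simp [gen, hv, h.x_mul_e_of_ne _ _ hv]
        · intro j' _ hj
          split_ifs
          · simp [hj.symm]
          · rfl
        · simp
      rw [this]
      refine Submodule.sum_mem _ fun j _ => ?_
      split_ifs with hj
      · exact hc.single_mem_diffSupGen h hF j a hj _
      · exact Submodule.zero_mem _
  have hsum : u = ∑ j, ∑ r, u j r • c.gen e (Pi.single j (Pi.single r (1 : k))) := by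
    funext j r
    simp only [Finset.sum_apply, Pi.smul_apply]
    rw [Finset.sum_eq_single j, Finset.sum_eq_single r]
    · simp [gen, hu]
    · intro r' _ hr
      simp [gen, hr.symm]
    · simp
    · intro j' _ hj
      exact Finset.sum_eq_zero fun r' _ => by simp [gen, hj.symm]
    · simp
  rw [hsum]
  refine Submodule.sum_mem _ fun j _ => Submodule.sum_mem _ fun r _ => ?_
  have : u j r ∈ T := hT ▸ Algebra.mem_top
  exact this _

end Differential

end CyclicWord

namespace CyclicWord

/-! ### The resolutions of a module attached to a cyclic word -/

section Resolution

variable {k : Type u} {ι R V E : Type*} [Field k] [Ring R] [Algebra k R] {n : ℕ}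

/-- The left module `⨁ (R e_{f j})^n`, as a submodule of a free module. -/
def peirce (n : ℕ) (e : V → R) (f : ι → V) : Submodule R (ι → Fin n → R) where
  carrier := {u | ∀ j r, u j r * e (f j) = u j r}
  zero_mem' := fun j r => zero_mul _
  add_mem' := fun hu hv j r => by simp only [Pi.add_apply, add_mul, hu j r, hv j r]
  smul_mem' := fun a u hu j r => by simp only [Pi.smul_apply, smul_eq_mul, mul_assoc, hu j r]

theorem projective_peirce [Finite ι] {e : V → R} (he : ∀ v, e v * e v = e v) (f : ι → V) :
    Module.Projective R (peirce n e f) := by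
  let p : (ι → Fin n → R) →ₗ[R] peirce n e f :=
    LinearMap.codRestrict _ (LinearMap.pi fun j => rightMul n (e (f j)) ∘ₗ LinearMap.proj j)
      fun u j r => by simp [rightMul_apply, mul_assoc, he]
  refine Module.Projective.of_split (peirce n e f).subtype p (LinearMap.ext fun u => ?_)
  exact Subtype.ext (funext fun j => funext fun r => u.2 j r)

variable {c : CyclicWord ι V E} {s t : E → V} {e : V → R} {x : E → R}

theorem IsReduced.diff_mem_peirce (hc : c.IsReduced s t x) (h : IsGentleSystem k s t e x)
    (F : ι → Matrix (Fin n) (Fin n) k) (w : ι → Fin n → R)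
    (hw : w ∈ peirce n e fun i => t (c.arr i)) : c.diff x F w ∈ peirce n e c.vert := by
  have hx : ∀ i, rightMul n (e (c.vert (c.src i))) (rightMul n (x (c.arr i)) (w i)) =
      rightMul n (x (c.arr i)) (w i) := fun i => by
    funext r
    simp only [rightMul_apply]
    rw [mul_assoc, hc.vert_src, h.x_mul_e]
  have hF : ∀ i, rightMul n (e (c.vert (c.tgt i))) (matAct R (F i) (w i)) =
      matAct R (F i) (w i) := fun i => by
    rw [rightMul_matAct, hc.vert_tgt]
    exact congrArg _ (funext fun r => hw i r)
  have hout : ∀ i, rightMul n (e (c.vert i)) (c.outMap x F i (w i)) = c.outMap x F i (w i) := by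
    intro i
    have h1 := hx i
    have h2 := hF i
    cases hi : c.dir i <;>
      simp only [outMap, src, tgt, hi, if_true, if_false, Bool.false_eq_true, LinearMap.neg_apply,
        map_neg] at h1 h2 ⊢
    · rw [h2]
    · rw [h1]
  have hin : ∀ i, rightMul n (e (c.vert (c.nxt i))) (c.inMap x F i (w i)) =
      c.inMap x F i (w i) := by
    intro i
    have h1 := hx i
    have h2 := hF i
    cases hi : c.dir i <;>
      simp only [inMap, src, tgt, hi, if_true, if_false, Bool.false_eq_true, LinearMap.neg_apply,
        map_neg] at h1 h2 ⊢
    · rw [h1]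
    · rw [h2]
  intro j r
  rw [diff_apply, ← rightMul_apply, map_add, hout]
  have := hin (c.nxt.symm j)
  rw [Equiv.apply_symm_apply] at this
  rw [this]

/-- The differential on projective modules. -/
def IsReduced.diffHom (hc : c.IsReduced s t x) (h : IsGentleSystem k s t e x)
    (F : ι → Matrix (Fin n) (Fin n) k) :
    peirce n e (fun i => t (c.arr i)) →ₗ[R] peirce n e c.vert :=
  (c.diff x F).restrict (hc.diff_mem_peirce h F)

theorem IsReduced.diffHom_injective (hc : c.IsReduced s t x) (h : IsGentleSystem k s t e x)
    {F : ι → Matrix (Fin n) (Fin n) k} (hF : ∀ i, IsUnit (F i)) [Nonempty ι] :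
    Function.Injective (hc.diffHom h F) := by
  rw [injective_iff_map_eq_zero]
  intro w hw
  exact Subtype.ext (hc.eq_zero_of_diff h hF w.1 w.2 (congrArg Subtype.val hw))

theorem IsReduced.gen_mem_peirce (h : IsGentleSystem k s t e x) (z : ι → Fin n → k) :
    c.gen e z ∈ peirce n e c.vert := fun j r => by
  simp [gen, h.e_mul_e]

theorem IsReduced.exists_eq_diffHom_add_gen [Fintype ι] (hc : c.IsReduced s t x)
    (h : IsGentleSystem k s t e x) {F : ι → Matrix (Fin n) (Fin n) k} (hF : ∀ i, IsUnit (F i))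
    (u : peirce n e c.vert) : ∃ w z, u = hc.diffHom h F w + ⟨c.gen e z, gen_mem_peirce h z⟩ := by
  obtain ⟨w, z, hw, hu⟩ := hc.mem_diffSupGen h hF u.1 u.2
  exact ⟨⟨w, hw⟩, z, Subtype.ext hu⟩

theorem diff_eq_sum [Fintype ι] [DecidableEq ι] (F : ι → Matrix (Fin n) (Fin n) k)
    (w : ι → Fin n → R) : c.diff x F w = ∑ i, (Pi.single (c.src i) (rightMul n (x (c.arr i)) (w i)) -
        Pi.single (c.tgt i) (matAct R (F i) (w i))) := by
  rw [← Finset.univ_sum_single w, map_sum]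
  simp only [diff_single, Finset.univ_sum_single]

/-- A left module with a `k`-basis `δ j r`, where the arrow at the letter `i` acts from the part at
the source of `i` to the part at the target of `i` by the matrix `F i`, has projective dimension at
most one. -/
theorem IsReduced.hasProjectiveDimensionLE_one [Fintype ι] [Nonempty ι] [Small.{u} R]
    (hc : c.IsReduced s t x) (h : IsGentleSystem k s t e x)
    {F : ι → Matrix (Fin n) (Fin n) k} (hF : ∀ i, IsUnit (F i))
    (M : ModuleCat.{u} R) [Module k M] [IsScalarTower k R M] (δ : ι → Fin n → M)
    (he : ∀ j r, e (c.vert j) • δ j r = δ j r)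
    (hx : ∀ i r, x (c.arr i) • δ (c.src i) r = ∑ l, F i l r • δ (c.tgt i) l)
    (hinj : ∀ z : ι → Fin n → k, ∑ j, ∑ r, z j r • δ j r = 0 → z = 0)
    (hsurj : ∀ m : M, ∃ z : ι → Fin n → k, ∑ j, ∑ r, z j r • δ j r = m) :
    HasProjectiveDimensionLE M 1 := by
  classical
  have := projective_peirce (n := n) h.e_mul_e c.vert
  have := projective_peirce (n := n) h.e_mul_e fun i => t (c.arr i)
  let π : (ι → Fin n → R) →ₗ[R] M :=
    ∑ j, ∑ r, LinearMap.toSpanSingleton R M (δ j r) ∘ₗ LinearMap.proj r ∘ₗ LinearMap.proj j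
  have hπ : ∀ u, π u = ∑ j, ∑ r, u j r • δ j r := fun u => by
    simp [π, LinearMap.sum_apply]
  have hπs : ∀ j (v : Fin n → R), π (Pi.single j v) = ∑ r, v r • δ j r := fun j v => by
    rw [hπ, Finset.sum_eq_single j]
    · simp
    · intro j' _ hj; simp [hj]
    · simp
  have hπd : ∀ w, π (c.diff x F w) = 0 := fun w => by
    rw [diff_eq_sum, map_sum]
    refine Finset.sum_eq_zero fun i _ => ?_
    rw [map_sub, hπs, hπs, sub_eq_zero]
    simp only [rightMul_apply, mul_smul, hx, matAct_apply, Finset.smul_sum, Finset.sum_smul]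
    rw [Finset.sum_comm]
    refine Finset.sum_congr rfl fun l _ => Finset.sum_congr rfl fun r _ => ?_
    rw [smul_assoc, smul_comm]
  have hπg : ∀ z : ι → Fin n → k, π (c.gen e z) = ∑ j, ∑ r, z j r • δ j r := fun z => by
    rw [hπ]
    simp only [gen, smul_assoc, he]
  refine hasProjectiveDimensionLE_one_of_exact (hc.diffHom h F) (π ∘ₗ (peirce n e c.vert).subtype)
    (hc.diffHom_injective h hF) (fun u => ⟨fun hu => ?_, ?_⟩) fun m => ?_
  -- Since `π` kills the image of the differential, a kernel element forces `∑ z j r • δ j r = 0`,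
  -- hence `z = 0` by independence.
  · obtain ⟨w, z, rfl⟩ := hc.exists_eq_diffHom_add_gen h hF u
    have h1 : π (c.diff x F w.1 + c.gen e z) = 0 := hu
    rw [map_add, hπd, zero_add, hπg] at h1
    refine ⟨w, ?_⟩
    have h2 : (⟨c.gen e z, gen_mem_peirce h z⟩ : peirce n e c.vert) = 0 := by
      rw [hinj z h1]
      refine Subtype.ext ?_
      funext j r
      simp [gen]
    rw [h2, add_zero]
  · rintro ⟨w, rfl⟩
    exact hπd w.1
  · obtain ⟨z, rfl⟩ := hsurj m
    exact ⟨⟨c.gen e z, gen_mem_peirce h z⟩, hπg z⟩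

/-- A right module with `k`-coordinates `ε j r`, where the arrow at the letter `i` acts from the part
at the target of `i` to the part at the source of `i` by the transpose of the matrix `F i`, has
injective dimension at most one. -/
theorem IsReduced.hasInjectiveDimensionLE_one [Fintype ι] [Nonempty ι] [Small.{u} R]
    (hc : c.IsReduced s t x) (h : IsGentleSystem k s t e x)
    {F : ι → Matrix (Fin n) (Fin n) k} (hF : ∀ i, IsUnit (F i))
    (M : ModuleCat.{u} Rᵐᵒᵖ) [Module k M] [IsScalarTower k Rᵐᵒᵖ M] (ε : ι → Fin n → M →ₗ[k] k)
    (he : ∀ j r m, ε j r (MulOpposite.op (e (c.vert j)) • m) = ε j r m)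
    (hx : ∀ i r m, ε (c.src i) r (MulOpposite.op (x (c.arr i)) • m) =
      ∑ l, F i l r * ε (c.tgt i) l m)
    (hinj : ∀ m, (∀ j r, ε j r m = 0) → m = 0)
    (hsurj : ∀ z : ι → Fin n → k, ∃ m, ∀ j r, ε j r m = z j r) :
    HasInjectiveDimensionLE M 1 := by
  classical
  have := projective_peirce (n := n) h.e_mul_e c.vert
  have := projective_peirce (n := n) h.e_mul_e fun i => t (c.arr i)
  -- This pairing of `M` with the free module vanishes on the image of the differential. Restricted
  -- to `P₀`, it embeds `M` in the dual of `P₀`.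
  let ρ : M →ₗ[k] (ι → Fin n → R) →ₗ[k] k :=
    LinearMap.mk₂ k (fun m u => ∑ j, ∑ r, ε j r (MulOpposite.op (u j r) • m))
      (fun m m' u => by simp [Finset.sum_add_distrib])
      (fun b m u => by simp [Finset.mul_sum, smul_comm _ b])
      (fun m u u' => by simp [Finset.sum_add_distrib, add_smul])
      (fun b m u => by simp [Finset.mul_sum])
  have hρ : ∀ m u, ρ m u = ∑ j, ∑ r, ε j r (MulOpposite.op (u j r) • m) := fun m u => rfl
  have hρs : ∀ m j (v : Fin n → R), ρ m (Pi.single j v) =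
      ∑ r, ε j r (MulOpposite.op (v r) • m) := fun m j v => by
    rw [hρ, Finset.sum_eq_single j]
    · simp
    · intro j' _ hj; simp [hj]
    · simp
  have hρd : ∀ m w, ρ m (c.diff x F w) = 0 := fun m w => by
    rw [diff_eq_sum, map_sum]
    refine Finset.sum_eq_zero fun i _ => ?_
    rw [map_sub, hρs, hρs, sub_eq_zero]
    simp only [rightMul_apply, MulOpposite.op_mul, mul_smul, hx, matAct_apply, Finset.op_sum,
      MulOpposite.op_smul, Finset.sum_smul, map_sum, smul_assoc, map_smul, smul_eq_mul]
    exact Finset.sum_comm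
  have hρg : ∀ m (z : ι → Fin n → k), ρ m (c.gen e z) = ∑ j, ∑ r, z j r * ε j r m := fun m z => by
    rw [hρ]
    simp only [gen, MulOpposite.op_smul, smul_assoc, he, map_smul, smul_eq_mul]
  let i₀ : M →ₗ[Rᵐᵒᵖ] RightDual k R (peirce n e c.vert) :=
    { toFun := fun m => ρ m ∘ₗ (peirce n e c.vert).subtype.restrictScalars k
      map_add' := fun m m' => by rw [map_add]; rfl
      map_smul' := fun a m => RightDual.ext fun u => by
        refine Finset.sum_congr rfl fun j _ => Finset.sum_congr rfl fun r _ => ?_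
        rw [← mul_smul]
        rfl }
  let d : RightDual k R (peirce n e c.vert) →ₗ[Rᵐᵒᵖ]
      RightDual k R (peirce n e fun i => t (c.arr i)) :=
    { toFun := fun φ => LinearMap.comp (show _ →ₗ[k] k from φ)
        ((hc.diffHom h F).restrictScalars k)
      map_add' := fun φ ψ => rfl
      map_smul' := fun a φ => RightDual.ext fun w =>
        congrArg φ (map_smul (hc.diffHom h F) a.unop w).symm }
  have hsm : ∀ f : ι → V, Small.{u} (RightDual k R (peirce n e f)) := fun f =>
    small_of_injective (f := fun φ => (φ : peirce n e f → k)) DFunLike.coe_injective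
  have := hsm c.vert
  have := hsm fun i => t (c.arr i)
  refine hasInjectiveDimensionLE_one_of_exact (RightDual.baer k R _) (RightDual.baer k R _) i₀ d
    ((injective_iff_map_eq_zero i₀).2 fun m hm => hinj m fun j r => ?_)
    (fun φ => ⟨fun hφ => ?_, ?_⟩) fun ψ => ?_
  · have h1 : ρ m (c.gen e (Pi.single j (Pi.single r (1 : k)))) = 0 :=
      DFunLike.congr_fun hm (⟨_, gen_mem_peirce h _⟩ : peirce n e c.vert)
    rw [hρg, Finset.sum_eq_single j, Finset.sum_eq_single r] at h1
    · simpa using h1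
    · intro r' _ hr; simp [hr]
    · simp
    · intro j' _ hj; simp [hj]
    · simp
  · let γ : (ι → Fin n → k) →ₗ[k] peirce n e c.vert :=
      { toFun := fun z => ⟨c.gen e z, gen_mem_peirce h z⟩
        map_add' := fun z z' => Subtype.ext (by funext j r; simp [gen, add_smul])
        map_smul' := fun b z => Subtype.ext (by funext j r; simp [gen, mul_smul]) }
    -- A functional that vanishes on the image is determined by its values on the generators, so `m`
    -- is chosen to have these values as coordinates.
    obtain ⟨m, hm⟩ := hsurj fun j r => φ (γ (Pi.single j (Pi.single r 1)))
    refine ⟨m, RightDual.ext fun u => ?_⟩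
    obtain ⟨w, z, rfl⟩ := hc.exists_eq_diffHom_add_gen h hF u
    have h1 : φ (hc.diffHom h F w) = 0 := DFunLike.congr_fun hφ w
    have h2 : i₀ m (hc.diffHom h F w) = 0 := hρd m w.1
    have h3 : i₀ m (γ z) = φ (γ z) := by
      refine (hρg m z).trans ?_
      have hz : z = ∑ j, ∑ r, z j r • (Pi.single j (Pi.single r 1) : ι → Fin n → k) := by
        funext j r
        simp only [Finset.sum_apply, Pi.smul_apply]
        rw [Finset.sum_eq_single j, Finset.sum_eq_single r]
        · simp
        · intro r' _ hr
          simp [hr.symm]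
        · simp
        · intro j' _ hj
          exact Finset.sum_eq_zero fun r' _ => by simp [hj.symm]
        · simp
      conv_rhs => rw [hz]
      simp only [map_sum, map_smul, smul_eq_mul, hm]
    rw [map_add, map_add, h1, h2]
    exact congrArg _ h3
  · rintro ⟨m, rfl⟩
    exact RightDual.ext fun w => hρd m w.1
  -- Over the field `k` the injective differential has a retraction, and functionals extend along
  -- it.
  · have hinj' : Function.Injective ((hc.diffHom h F).restrictScalars k) :=
      hc.diffHom_injective h hF
    obtain ⟨g, hg⟩ := LinearMap.exists_leftInverse_of_injective _ (LinearMap.ker_eq_bot.2 hinj')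
    refine ⟨LinearMap.comp (show _ →ₗ[k] k from ψ) g, RightDual.ext fun w => ?_⟩
    exact congrArg ψ (LinearMap.congr_fun hg w)

end Resolution

end CyclicWord

/-! ## Gentle algebras are gentle systems -/

/-! ### Paths as lists of arrows -/

section Paths

variable {V : Type v} [Quiver.{w} V]

/-- The list of arrows of a path. -/
def arrows {x : V} : {y : V} → Quiver.Path x y → List (Quiver.Total V)
  | _, .nil => []
  | _, .cons p f => arrows p ++ [⟨_, _, f⟩]

theorem arrows_comp {x y z : V} (p : Quiver.Path x y) (q : Quiver.Path y z) :
    arrows (p.comp q) = arrows p ++ arrows q := by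
  induction q with
  | nil => simp [arrows]
  | cons q f ih => simp [arrows, ih]

theorem arrows_toPath (a : Quiver.Total V) : arrows a.hom.toPath = [a] := rfl

theorem src_of_mem_head? {x y : V} (p : Quiver.Path x y) :
    ∀ a ∈ (arrows p).head?, a.left = x := by
  induction p with
  | nil => simp [arrows]
  | cons p f ih =>
    intro a ha
    rw [arrows, List.head?_append] at ha
    cases p with
    | nil => simp only [arrows] at ha; cases ha; rfl
    | cons p g =>
      refine ih a ?_
      rw [arrows, List.head?_append] at ha ⊢
      cases h : (arrows p).head? <;> simp_all

theorem tgt_of_mem_getLast? {x y : V} (p : Quiver.Path x y) :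
    ∀ a ∈ (arrows p).getLast?, a.right = y := by
  cases p with
  | nil => simp [arrows]
  | cons p f =>
    intro a ha
    simp only [arrows, List.getLast?_append, List.getLast?_singleton] at ha
    cases ha; rfl

/-- The source must be given separately, because all trivial paths have the empty list of arrows. -/
theorem PathOf.ext_arrows {p q : PathOf V} (hs : p.src = q.src)
    (h : arrows p.path = arrows q.path) : p = q := by
  obtain ⟨x, y, p⟩ := p
  obtain ⟨x', z, q⟩ := q
  obtain rfl : x = x' := hs
  replace h : arrows p = arrows q := h
  induction p generalizing z with
  | nil =>
    cases q with
    | nil => rfl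
    | cons q g => simp [arrows] at h
  | cons p f ih =>
    cases q with
    | nil => simp [arrows] at h
    | cons q g =>
      obtain ⟨h1, h2⟩ := List.append_inj' h rfl
      cases ih _ q h1
      cases h2
      rfl

end Paths

/-! ### Coefficients of products with arrows and trivial paths -/

section Coeff

variable {k : Type u} [Field k] {V : Type v} [Quiver.{w} V]

/-- The coefficient of a path. -/
def coeff (p : PathOf V) : PathAlgebra k V →ₗ[k] k := Finsupp.lapply p

theorem coeff_ofPath_self (p : PathOf V) : coeff p (ofPath k p) = 1 := Finsupp.single_eq_same

theorem coeff_ofPath_of_ne {p q : PathOf V} (h : q ≠ p) : coeff p (ofPath k q) = 0 :=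
  Finsupp.single_eq_of_ne (by first | exact h | exact h.symm)

theorem linear_induction {P : PathAlgebra k V → Prop} (r : PathAlgebra k V) (h0 : P 0)
    (hadd : ∀ r s, P r → P s → P (r + s)) (hpath : ∀ (c : k) p, P (c • ofPath k p)) : P r := by
  refine Finsupp.induction_linear r h0 hadd fun p c => ?_
  have : (Finsupp.single p c : PathOf V →₀ k) = c • Finsupp.single p 1 := by simp
  rw [this]
  exact hpath c p

/-- A path beginning with `a` has a unique remainder, so distinct paths stay distinct after
prepending `a`. -/
theorem coeff_ofArrow_mul (a : Quiver.Total V) {y : V} (p : Quiver.Path a.right y)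
    (r : PathAlgebra k V) :
    coeff ⟨a.left, y, a.hom.toPath.comp p⟩ (ofArrow k a * r) = coeff ⟨a.right, y, p⟩ r := by
  refine LinearMap.congr_fun (f := coeff _ ∘ₗ mulBilin (ofArrow k a)) (PathAlgebra.hom_ext ?_) r
  rintro ⟨u, z, q⟩
  change coeff _ (ofArrow k a * ofPath k _) = _
  by_cases hu : a.right = u
  · subst hu
    rw [ofArrow, ofPath_mul_comp]
    by_cases h : (⟨a.right, z, q⟩ : PathOf V) = ⟨a.right, y, p⟩
    · cases h
      rw [coeff_ofPath_self, coeff_ofPath_self]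
    · rw [coeff_ofPath_of_ne h, coeff_ofPath_of_ne]
      refine fun h' => h (PathOf.ext_arrows rfl ?_)
      have := congrArg (fun p : PathOf V => arrows p.path) h'
      simpa [arrows_comp] using this
  · rw [ofArrow, ofPath_mul_of_ne (by exact hu), map_zero, coeff_ofPath_of_ne]
    exact fun h => hu (congrArg PathOf.src h).symm

theorem coeff_mul_ofArrow (a : Quiver.Total V) {x : V} (p : Quiver.Path x a.left)
    (r : PathAlgebra k V) :
    coeff ⟨x, a.right, p.comp a.hom.toPath⟩ (r * ofArrow k a) = coeff ⟨x, a.left, p⟩ r := by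
  refine LinearMap.congr_fun (f := coeff _ ∘ₗ mulBilin.flip (ofArrow k a))
    (PathAlgebra.hom_ext ?_) r
  rintro ⟨u, z, q⟩
  change coeff _ (ofPath k _ * ofArrow k a) = _
  by_cases hu : z = a.left
  · subst hu
    rw [ofArrow, ofPath_mul_comp]
    by_cases h : (⟨u, a.left, q⟩ : PathOf V) = ⟨x, a.left, p⟩
    · cases h
      rw [coeff_ofPath_self, coeff_ofPath_self]
    · rw [coeff_ofPath_of_ne h, coeff_ofPath_of_ne]
      intro h'
      have hs : u = x := congrArg PathOf.src h'
      have := congrArg (fun p : PathOf V => arrows p.path) h'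
      simp only [arrows_comp, List.append_cancel_right_eq] at this
      exact h (PathOf.ext_arrows hs this)
  · rw [ofArrow, ofPath_mul_of_ne (by exact hu), map_zero, coeff_ofPath_of_ne]
    exact fun h => hu (congrArg PathOf.tgt h)

theorem coeff_ofArrow_mul_eq_zero (a : Quiver.Total V) (p : PathOf V)
    (hp : (arrows p.path).head? ≠ some a) (r : PathAlgebra k V) :
    coeff p (ofArrow k a * r) = 0 := by
  refine LinearMap.congr_fun (f := coeff _ ∘ₗ mulBilin (ofArrow k a)) (g := 0)
    (PathAlgebra.hom_ext ?_) r
  rintro ⟨u, z, q⟩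
  change coeff _ (ofArrow k a * ofPath k _) = 0
  by_cases hu : a.right = u
  · subst hu
    rw [ofArrow, ofPath_mul_comp, coeff_ofPath_of_ne]
    rintro rfl
    exact hp (by rw [arrows_comp, arrows_toPath]; rfl)
  · rw [ofArrow, ofPath_mul_of_ne (by exact hu), map_zero]

theorem coeff_mul_ofArrow_eq_zero (a : Quiver.Total V) (p : PathOf V)
    (hp : (arrows p.path).getLast? ≠ some a) (r : PathAlgebra k V) :
    coeff p (r * ofArrow k a) = 0 := by
  refine LinearMap.congr_fun (f := coeff _ ∘ₗ mulBilin.flip (ofArrow k a)) (g := 0)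
    (PathAlgebra.hom_ext ?_) r
  rintro ⟨u, z, q⟩
  change coeff _ (ofPath k _ * ofArrow k a) = 0
  by_cases hu : z = a.left
  · subst hu
    rw [ofArrow, ofPath_mul_comp, coeff_ofPath_of_ne]
    rintro rfl
    exact hp (by rw [arrows_comp, arrows_toPath, List.getLast?_append]; rfl)
  · rw [ofArrow, ofPath_mul_of_ne (by exact hu), map_zero]

theorem coeff_idem_mul_eq_zero (x : V) (p : PathOf V) (hp : p.src ≠ x) (r : PathAlgebra k V) :
    coeff p (idem k x * r) = 0 := by
  classical
  refine LinearMap.congr_fun (f := coeff _ ∘ₗ mulBilin (idem k x)) (g := 0)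
    (PathAlgebra.hom_ext fun q => ?_) r
  change coeff _ (idem k x * ofPath k _) = 0
  rw [PathAlgebra.idem_mul_ofPath]
  split_ifs with h
  · exact coeff_ofPath_of_ne (by rintro rfl; exact hp h.symm)
  · exact map_zero _

theorem coeff_mul_idem_eq_zero (x : V) (p : PathOf V) (hp : p.tgt ≠ x) (r : PathAlgebra k V) :
    coeff p (r * idem k x) = 0 := by
  classical
  refine LinearMap.congr_fun (f := coeff _ ∘ₗ mulBilin.flip (idem k x)) (g := 0)
    (PathAlgebra.hom_ext fun q => ?_) r
  change coeff _ (ofPath k _ * idem k x) = 0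
  rw [PathAlgebra.ofPath_mul_idem]
  split_ifs with h
  · exact coeff_ofPath_of_ne (by rintro rfl; exact hp h)
  · exact map_zero _

end Coeff

/-! ### The ideal of a gentle pair is spanned by paths -/

section Gentle

variable {k : Type u} [Field k] {V : Type v} [Quiver.{w} V] [Fintype V]

/-- Lists of arrows without relations. -/
def IsAllowed (I : TwoSidedIdeal (PathAlgebra k V)) (l : List (Quiver.Total V)) : Prop :=
  l.IsChain fun a b => ofArrow k a * ofArrow k b ∉ I

variable {I : TwoSidedIdeal (PathAlgebra k V)}

theorem smul_mem (c : k) {r : PathAlgebra k V} (hr : r ∈ I) : c • r ∈ I := by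
  rw [Algebra.smul_def]
  exact I.mul_mem_left _ _ hr

theorem ofPath_mem_of_not_isAllowed {x y : V} (p : Quiver.Path x y)
    (hp : ¬ IsAllowed I (arrows p)) : ofPath k ⟨x, y, p⟩ ∈ I := by
  induction p with
  | nil => exact (hp List.IsChain.nil).elim
  | @cons b c p f ih =>
    have hc : ofPath k ⟨x, c, p.cons f⟩ = ofPath k ⟨x, b, p⟩ * ofArrow k ⟨b, c, f⟩ :=
      (ofPath_mul_comp (k := k) p f.toPath).symm
    by_cases h : IsAllowed I (arrows p)
    · cases p with
      | nil => exact (hp (List.isChain_singleton _)).elim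
      | @cons a _ p g =>
        have hc' : ofPath k ⟨x, b, p.cons g⟩ = ofPath k ⟨x, a, p⟩ * ofArrow k ⟨a, b, g⟩ :=
          (ofPath_mul_comp (k := k) p g.toPath).symm
        rw [hc, hc', mul_assoc]
        refine I.mul_mem_left _ _ ?_
        by_contra hn
        refine hp (List.isChain_append.2 ⟨h, List.isChain_singleton _, ?_⟩)
        simpa [arrows] using hn
    · rw [hc]
      exact I.mul_mem_right _ _ (ih h)

/-- The span `K` of the paths containing a relation is a two-sided ideal and contains the quadratic
generators, so `I ≤ K`; conversely each such path lies in `I`. Membership in `I` thus becomes a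
condition on coefficients, path by path. -/
theorem IsGentlePair.mem_iff (hI : IsGentlePair I) {r : PathAlgebra k V} :
    r ∈ I ↔ ∀ p : PathOf V, IsAllowed I (arrows p.path) → coeff p r = 0 := by
  constructor
  · let K : Submodule k (PathAlgebra k V) :=
      Submodule.span k {x | ∃ p : PathOf V, ¬ IsAllowed I (arrows p.path) ∧ x = ofPath k p}
    have hl : ∀ s r : PathAlgebra k V, r ∈ K → s * r ∈ K := by
      intro s r hr
      induction hr using Submodule.span_induction with
      | zero => rw [mul_zero]; exact K.zero_mem
      | add x y _ _ hx hy => rw [mul_add]; exact K.add_mem hx hy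
      | smul c x _ hx => rw [mul_smul_comm]; exact K.smul_mem _ hx
      | mem x hx =>
        obtain ⟨⟨a, b, p⟩, hp, rfl⟩ := hx
        refine linear_induction (P := fun s => s * _ ∈ K) s (by rw [zero_mul]; exact K.zero_mem)
          (fun _ _ h h' => by rw [add_mul]; exact K.add_mem h h') fun c q => ?_
        rw [smul_mul_assoc]
        refine K.smul_mem _ ?_
        obtain ⟨a', b', q⟩ := q
        by_cases h : b' = a
        · subst h
          rw [ofPath_mul_comp]
          refine Submodule.subset_span ⟨_, fun h => hp ?_, rfl⟩
          rw [arrows_comp] at h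
          exact (List.isChain_append.1 h).2.1
        · rw [ofPath_mul_of_ne h]; exact K.zero_mem
    have hr : ∀ r s : PathAlgebra k V, r ∈ K → r * s ∈ K := by
      intro r s hr
      induction hr using Submodule.span_induction with
      | zero => rw [zero_mul]; exact K.zero_mem
      | add x y _ _ hx hy => rw [add_mul]; exact K.add_mem hx hy
      | smul c x _ hx => rw [smul_mul_assoc]; exact K.smul_mem _ hx
      | mem x hx =>
        obtain ⟨⟨a, b, p⟩, hp, rfl⟩ := hx
        refine linear_induction (P := fun s => _ * s ∈ K) s (by rw [mul_zero]; exact K.zero_mem)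
          (fun _ _ h h' => by rw [mul_add]; exact K.add_mem h h') fun c q => ?_
        rw [mul_smul_comm]
        refine K.smul_mem _ ?_
        obtain ⟨a', b', q⟩ := q
        by_cases h : b = a'
        · subst h
          rw [ofPath_mul_comp]
          refine Submodule.subset_span ⟨_, fun h => hp ?_, rfl⟩
          rw [arrows_comp] at h
          exact (List.isChain_append.1 h).1
        · rw [ofPath_mul_of_ne h]; exact K.zero_mem
    let K' : TwoSidedIdeal (PathAlgebra k V) := TwoSidedIdeal.mk' K K.zero_mem K.add_mem
      K.neg_mem (hl _ _) (hr _ _)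
    have hIK : I ≤ K' := by
      obtain ⟨S, hS, hIS⟩ := hI.generated
      refine hIS.le.trans (TwoSidedIdeal.span_le.2 ?_)
      rintro _ ⟨⟨a, b⟩, hp, rfl⟩
      have hab : ofArrow k a * ofArrow k b ∈ I := by
        rw [hIS]; exact TwoSidedIdeal.subset_span ⟨_, hp, rfl⟩
      refine (TwoSidedIdeal.mem_mk' ..).2 (Submodule.subset_span ?_)
      obtain ⟨a₁, a₂, a⟩ := a
      obtain ⟨b₁, b₂, b⟩ := b
      obtain rfl : a₂ = b₁ := hS _ hp
      refine ⟨⟨a₁, b₂, a.toPath.comp b.toPath⟩, fun h => ?_, ofPath_mul_comp _ _⟩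
      exact (List.isChain_cons_cons.1 h).1 hab
    intro h p hp
    have hK : r ∈ K := (TwoSidedIdeal.mem_mk' ..).1 (hIK h)
    have hle : K ≤ LinearMap.ker (coeff p) := Submodule.span_le.2 (by
      rintro _ ⟨q, hq, rfl⟩
      exact coeff_ofPath_of_ne (by rintro rfl; exact hq hp))
    exact hle hK
  · intro h
    have : r = ∑ p ∈ Finsupp.support r, coeff p r • ofPath k p := by
      refine (Finsupp.sum_single (r : PathOf V →₀ k)).symm.trans (Finset.sum_congr rfl fun p _ => ?_)
      exact (Finsupp.smul_single_one p (coeff p r)).symm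
    rw [this]
    refine sum_mem fun p _ => ?_
    by_cases hp : IsAllowed I (arrows p.path)
    · rw [h p hp, zero_smul]; exact I.zero_mem
    · exact smul_mem _ (ofPath_mem_of_not_isAllowed p.path hp)

theorem composable_of_notMem {a b : Quiver.Total V} (h : ofArrow k a * ofArrow k b ∉ I) :
    a.right = b.left := by
  by_contra hn
  refine h ?_
  rw [ofArrow, ofArrow, ofPath_mul_of_ne (by exact hn)]
  exact I.zero_mem

/-- No path begins with both `a` and `b`, so the two summands have disjoint supports. -/
theorem IsGentlePair.ofArrow_mul_mem_of_add_mem (hI : IsGentlePair I) {a b : Quiver.Total V} (hab : a ≠ b)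
    {r s : PathAlgebra k V} (h : ofArrow k a * r + ofArrow k b * s ∈ I) : ofArrow k a * r ∈ I := by
  refine hI.mem_iff.2 fun p hp => ?_
  by_cases ha : (arrows p.path).head? = some a
  · have := hI.mem_iff.1 h p hp
    rwa [map_add, coeff_ofArrow_mul_eq_zero b p (by rw [ha]; simpa using hab), add_zero] at this
  · exact coeff_ofArrow_mul_eq_zero a p ha r

theorem IsGentlePair.mul_ofArrow_mem_of_add_mem (hI : IsGentlePair I) {a b : Quiver.Total V} (hab : a ≠ b)
    {r s : PathAlgebra k V} (h : r * ofArrow k a + s * ofArrow k b ∈ I) : r * ofArrow k a ∈ I := by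
  refine hI.mem_iff.2 fun p hp => ?_
  by_cases ha : (arrows p.path).getLast? = some a
  · have := hI.mem_iff.1 h p hp
    rwa [map_add, coeff_mul_ofArrow_eq_zero b p (by rw [ha]; simpa using hab), add_zero] at this
  · exact coeff_mul_ofArrow_eq_zero a p ha r

/-- Relations have length two: prepending `a` to a relation-free path that begins with `b` creates
only the pair `ab`, which is not a relation. -/
theorem IsGentlePair.ofArrow_mul_mem_of_mul_mem (hI : IsGentlePair I) {a b : Quiver.Total V}
    (hab : ofArrow k a * ofArrow k b ∉ I) {r : PathAlgebra k V}
    (h : ofArrow k a * (ofArrow k b * r) ∈ I) : ofArrow k b * r ∈ I := by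
  refine hI.mem_iff.2 fun p hp => ?_
  by_cases hb : (arrows p.path).head? = some b
  · obtain ⟨x, y, p⟩ := p
    obtain rfl : a.right = x := (composable_of_notMem hab).trans (src_of_mem_head? p b hb)
    rw [← coeff_ofArrow_mul]
    refine hI.mem_iff.1 h _ ?_
    rw [arrows_comp, arrows_toPath]
    refine List.isChain_cons.2 ⟨fun c hc => ?_, hp⟩
    obtain rfl : b = c := Option.some.inj (hb.symm.trans hc)
    exact hab
  · exact coeff_ofArrow_mul_eq_zero b p hb r

theorem IsGentlePair.mul_ofArrow_mem_of_mul_mem (hI : IsGentlePair I) {a b : Quiver.Total V}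
    (hab : ofArrow k a * ofArrow k b ∉ I) {r : PathAlgebra k V}
    (h : r * ofArrow k a * ofArrow k b ∈ I) : r * ofArrow k a ∈ I := by
  refine hI.mem_iff.2 fun p hp => ?_
  by_cases ha : (arrows p.path).getLast? = some a
  · obtain ⟨x, y, p⟩ := p
    obtain rfl : y = b.left := (tgt_of_mem_getLast? p a ha).symm.trans (composable_of_notMem hab)
    rw [← coeff_mul_ofArrow]
    refine hI.mem_iff.1 h _ ?_
    rw [arrows_comp, arrows_toPath]
    refine List.isChain_append.2 ⟨hp, List.isChain_singleton _, fun c hc d hd => ?_⟩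
    obtain rfl : a = c := Option.some.inj (ha.symm.trans hc)
    obtain rfl : b = d := Option.some.inj hd
    exact hab
  · exact coeff_mul_ofArrow_eq_zero a p ha r

/-- A relation-free path starting at the common target can be prolonged on the left by `a` or by
`b`. Otherwise both would have a relation with its first arrow, contrary to `left_mem`. -/
theorem IsGentlePair.mem_of_ofArrow_mul_mem (hI : IsGentlePair I) {a b : Quiver.Total V} (hab : a ≠ b)
    (hv : a.right = b.right) {r : PathAlgebra k V} (hr : idem k a.right * r - r ∈ I)
    (ha : ofArrow k a * r ∈ I) (hb : ofArrow k b * r ∈ I) : r ∈ I := by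
  refine hI.mem_iff.2 fun p hp => ?_
  obtain ⟨x, y, p⟩ := p
  by_cases hx : x = a.right
  · by_cases hap : IsAllowed I (a :: arrows p)
    · subst hx
      rw [← coeff_ofArrow_mul]
      refine hI.mem_iff.1 ha _ ?_
      rwa [arrows_comp, arrows_toPath]
    · by_cases hbp : IsAllowed I (b :: arrows p)
      · obtain rfl : x = b.right := hx.trans hv
        rw [← coeff_ofArrow_mul]
        refine hI.mem_iff.1 hb _ ?_
        rwa [arrows_comp, arrows_toPath]
      · exfalso
        simp only [IsAllowed, List.isChain_cons] at hap hbp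
        have h1 : ∀ a' : Quiver.Total V, ¬((∀ y ∈ (arrows p).head?,
            ofArrow k a' * ofArrow k y ∉ I) ∧ IsAllowed I (arrows p)) →
            ∃ c, c ∈ (arrows p).head? ∧ ofArrow k a' * ofArrow k c ∈ I := by
          intro a' h
          by_contra! hn
          exact h ⟨hn, hp⟩
        obtain ⟨c, hc, hac⟩ := h1 a hap
        obtain ⟨d, hd, hbd⟩ := h1 b hbp
        obtain rfl : c = d := Option.some.inj (hc.symm.trans hd)
        have hcs := src_of_mem_head? p c hc
        exact hab (hI.left_mem c a b (hx.symm.trans hcs.symm) (hv.symm.trans (hx.symm.trans hcs.symm)) hac hbd)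
  · have := hI.mem_iff.1 hr _ hp
    rw [map_sub, coeff_idem_mul_eq_zero _ _ hx, zero_sub, neg_eq_zero] at this
    exact this

theorem IsGentlePair.mem_of_mul_ofArrow_mem (hI : IsGentlePair I) {a b : Quiver.Total V} (hab : a ≠ b)
    (hv : a.left = b.left) {r : PathAlgebra k V} (hr : r * idem k a.left - r ∈ I)
    (ha : r * ofArrow k a ∈ I) (hb : r * ofArrow k b ∈ I) : r ∈ I := by
  refine hI.mem_iff.2 fun p hp => ?_
  obtain ⟨x, y, p⟩ := p
  by_cases hy : y = a.left
  · by_cases hap : IsAllowed I (arrows p ++ [a])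
    · subst hy
      rw [← coeff_mul_ofArrow]
      refine hI.mem_iff.1 ha _ ?_
      rwa [arrows_comp, arrows_toPath]
    · by_cases hbp : IsAllowed I (arrows p ++ [b])
      · obtain rfl : y = b.left := hy.trans hv
        rw [← coeff_mul_ofArrow]
        refine hI.mem_iff.1 hb _ ?_
        rwa [arrows_comp, arrows_toPath]
      · exfalso
        have h1 : ∀ a' : Quiver.Total V, ¬ IsAllowed I (arrows p ++ [a']) →
            ∃ c, c ∈ (arrows p).getLast? ∧ ofArrow k c * ofArrow k a' ∈ I := by
          intro a' h
          by_contra! hn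
          refine h (List.isChain_append.2 ⟨hp, List.isChain_singleton _, fun c hc d hd => ?_⟩)
          obtain rfl : a' = d := Option.some.inj hd
          exact hn c hc
        obtain ⟨c, hc, hac⟩ := h1 a hap
        obtain ⟨d, hd, hbd⟩ := h1 b hbp
        obtain rfl : c = d := Option.some.inj (hc.symm.trans hd)
        have hcs := tgt_of_mem_getLast? p c hc
        exact hab (hI.right_mem c a b (hcs.trans hy) (hcs.trans (hy.trans hv)) hac hbd)
  · have := hI.mem_iff.1 hr _ hp
    rw [map_sub, coeff_mul_idem_eq_zero _ _ hy, zero_sub, neg_eq_zero] at this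
    exact this

/-! ### The bound quiver algebra and its opposite as gentle systems -/

variable (I) in
/-- The class of a trivial path in the bound quiver algebra. -/
def vertexClass (v : V) : BoundAlgebra I := I.ringCon.mkₐ k (idem k v)

variable (I) in
/-- The class of an arrow in the bound quiver algebra. -/
def arrowClass (a : Quiver.Total V) : BoundAlgebra I := I.ringCon.mkₐ k (ofArrow k a)

theorem mk_eq_zero_iff (r : PathAlgebra k V) : I.ringCon.mkₐ k r = 0 ↔ r ∈ I :=
  I.ringCon.eq

theorem vertexClass_mul_self (v : V) : vertexClass I v * vertexClass I v = vertexClass I v := by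
  rw [vertexClass, ← map_mul, idem, ofPath_mul_comp]; rfl

theorem vertexClass_mul_of_ne {v v' : V} (h : v ≠ v') :
    vertexClass I v * vertexClass I v' = 0 := by
  rw [vertexClass, vertexClass, ← map_mul, idem, idem, ofPath_mul_of_ne (by exact h), map_zero]

theorem vertexClass_mul_arrowClass (a : Quiver.Total V) :
    vertexClass I a.left * arrowClass I a = arrowClass I a := by
  rw [vertexClass, arrowClass, ← map_mul, idem, ofArrow, ofPath_mul_comp]; rfl

theorem arrowClass_mul_vertexClass (a : Quiver.Total V) :
    arrowClass I a * vertexClass I a.right = arrowClass I a := by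
  rw [vertexClass, arrowClass, ← map_mul, idem, ofArrow, ofPath_mul_comp]; rfl

theorem vertexClass_mul_arrowClass_of_ne {a : Quiver.Total V} {v : V} (h : a.left ≠ v) :
    vertexClass I v * arrowClass I a = 0 := by
  rw [vertexClass, arrowClass, ← map_mul, idem, ofArrow, ofPath_mul_of_ne (by exact h.symm),
    map_zero]

theorem arrowClass_mul_vertexClass_of_ne {a : Quiver.Total V} {v : V} (h : a.right ≠ v) :
    arrowClass I a * vertexClass I v = 0 := by
  rw [vertexClass, arrowClass, ← map_mul, idem, ofArrow, ofPath_mul_of_ne (by exact h), map_zero]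

theorem arrowClass_mul_eq_zero_iff (a b : Quiver.Total V) :
    arrowClass I a * arrowClass I b = 0 ↔ ofArrow k a * ofArrow k b ∈ I := by
  rw [arrowClass, arrowClass, ← map_mul, mk_eq_zero_iff]

theorem adjoin_vertexClass_arrowClass :
    Algebra.adjoin k (Set.range (vertexClass I) ∪ Set.range (arrowClass I)) = ⊤ := by
  set S := Algebra.adjoin k (Set.range (vertexClass I) ∪ Set.range (arrowClass I))
  rw [eq_top_iff]
  intro y _
  obtain ⟨r, rfl⟩ := I.ringCon.mkₐ_surjective (α := k) y
  refine linear_induction (P := fun r => I.ringCon.mkₐ k r ∈ S) r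
    (by rw [map_zero]; exact S.zero_mem)
    (fun _ _ h h' => by rw [map_add]; exact S.add_mem h h') fun c p => ?_
  rw [map_smul]
  refine S.smul_mem ?_ c
  obtain ⟨x, z, p⟩ := p
  induction p with
  | nil => exact Algebra.subset_adjoin (Or.inl ⟨x, rfl⟩)
  | @cons b c p f ih =>
    have hc : ofPath k ⟨x, c, p.cons f⟩ = ofPath k ⟨x, b, p⟩ * ofArrow k ⟨b, c, f⟩ :=
      (ofPath_mul_comp (k := k) p f.toPath).symm
    rw [hc, map_mul]
    exact S.mul_mem ih (Algebra.subset_adjoin (Or.inr ⟨_, rfl⟩))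

theorem prod_ofArrow_mem_arrowIdealPow (l : List (Quiver.Total V)) :
    (l.map (ofArrow k)).prod ∈ arrowIdealPow k V l.length := by
  induction l with
  | nil =>
    rw [List.map_nil, List.prod_nil, PathAlgebra.one_def]
    exact Submodule.sum_mem _ fun v _ => Submodule.subset_span ⟨_, Nat.zero_le _, rfl⟩
  | cons a l ih =>
    rw [List.map_cons, List.prod_cons]
    have hle : arrowIdealPow k V l.length ≤
        (arrowIdealPow k V (a :: l).length).comap (mulBilin (ofArrow k a)) := by
      refine Submodule.span_le.2 ?_
      rintro _ ⟨⟨x, y, p⟩, hp, rfl⟩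
      change ofArrow k a * ofPath k _ ∈ arrowIdealPow k V (a :: l).length
      by_cases h : a.right = x
      · subst h
        rw [ofArrow, ofPath_mul_comp]
        refine Submodule.subset_span ⟨_, ?_, rfl⟩
        simp only [Quiver.Path.length_comp, List.length_cons, Quiver.Path.length_toPath] at hp ⊢
        omega
      · rw [ofArrow, ofPath_mul_of_ne (by exact h)]
        exact Submodule.zero_mem _
    exact hle ih

theorem IsGentlePair.exists_prod_arrowClass_eq_zero (hI : IsGentlePair I) :
    ∃ N, ∀ l : List (Quiver.Total V), N ≤ l.length → (l.map (arrowClass I)).prod = 0 := by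
  obtain ⟨m, -, hm⟩ := hI.admissible.1
  refine ⟨m, fun l hl => ?_⟩
  have h : (l.map (arrowClass I)).prod = I.ringCon.mkₐ k (l.map (ofArrow k)).prod := by
    rw [map_list_prod, List.map_map]; rfl
  rw [h, mk_eq_zero_iff]
  refine hm _ (Submodule.span_mono ?_ (prod_ofArrow_mem_arrowIdealPow l))
  rintro _ ⟨p, hp, rfl⟩
  exact ⟨p, hl.trans hp, rfl⟩

theorem eq_or_eq_of_encard_le_two {α : Type*} {s : Set α} (hs : s.encard ≤ 2) {a b c : α}
    (ha : a ∈ s) (hb : b ∈ s) (hc : c ∈ s) : a = b ∨ b = c ∨ a = c := by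
  by_contra! hn
  have h3 : ({a, b, c} : Set α).encard = 3 :=
    Set.encard_eq_three.2 ⟨a, b, c, hn.1, hn.2.2, hn.2.1, rfl⟩
  have hle : ({a, b, c} : Set α).encard ≤ s.encard := Set.encard_le_encard (by
    rintro _ (rfl | rfl | rfl) <;> assumption)
  rw [h3] at hle
  exact absurd (hle.trans hs) (by decide)

/-- A gentle algebra is a gentle system for the reversed arrows. -/
theorem IsGentlePair.isGentleSystem (hI : IsGentlePair I) :
    IsGentleSystem k (fun a => a.right) (fun a => a.left) (vertexClass I) (arrowClass I) where
  e_mul_e v := vertexClass_mul_self v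
  e_mul_e_of_ne v v' h := vertexClass_mul_of_ne h
  e_mul_x a := vertexClass_mul_arrowClass a
  x_mul_e a := arrowClass_mul_vertexClass a
  x_mul_e_of_ne a v h := arrowClass_mul_vertexClass_of_ne h
  adjoin_eq_top := adjoin_vertexClass_arrowClass
  nilpotent := hI.exists_prod_arrowClass_eq_zero
  src_le_two a b c h h' := eq_or_eq_of_encard_le_two (hI.in_le b.right) h rfl h'.symm
  mul_eq_zero_of_ne a b b' h h' hne hb := by
    by_contra hn
    rw [Ne, arrowClass_mul_eq_zero_iff] at hne
    rw [arrowClass_mul_eq_zero_iff] at hn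
    exact hb (hI.left_not_mem a b' b h' h hn hne)
  mul_eq_zero_or a a' b h h' hne := by
    by_contra! hn
    rw [Ne, Ne, arrowClass_mul_eq_zero_iff, arrowClass_mul_eq_zero_iff] at hn
    exact hne (hI.right_not_mem b a a' h.symm h'.symm hn.1 hn.2)
  mul_x_eq_zero a a' r r' hne h := by
    obtain ⟨r, rfl⟩ := I.ringCon.mkₐ_surjective (α := k) r
    obtain ⟨r', rfl⟩ := I.ringCon.mkₐ_surjective (α := k) r'
    rw [arrowClass, arrowClass, ← map_mul, ← map_mul, ← map_add, mk_eq_zero_iff] at h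
    rw [arrowClass, ← map_mul, mk_eq_zero_iff]
    exact hI.mul_ofArrow_mem_of_add_mem hne h
  mul_x_cancel a b r hne h := by
    obtain ⟨r, rfl⟩ := I.ringCon.mkₐ_surjective (α := k) r
    rw [Ne, arrowClass_mul_eq_zero_iff] at hne
    rw [arrowClass, arrowClass, ← map_mul, ← map_mul, mk_eq_zero_iff] at h
    rw [arrowClass, ← map_mul, mk_eq_zero_iff]
    exact hI.mul_ofArrow_mem_of_mul_mem hne h
  eq_zero_of_mul_x a a' r hne hv hr h h' := by
    obtain ⟨r, rfl⟩ := I.ringCon.mkₐ_surjective (α := k) r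
    rw [arrowClass, ← map_mul, mk_eq_zero_iff] at h h'
    rw [← sub_eq_zero, vertexClass, ← map_mul, ← map_sub, mk_eq_zero_iff] at hr
    rw [mk_eq_zero_iff]
    exact hI.mem_of_mul_ofArrow_mem hne hv hr h h'

open MulOpposite in
/-- The opposite of a gentle algebra is a gentle system. -/
theorem IsGentlePair.isGentleSystem_op (hI : IsGentlePair I) :
    IsGentleSystem k (R := (BoundAlgebra I)ᵐᵒᵖ) (fun a => a.left) (fun a => a.right)
      (fun v => op (vertexClass I v)) (fun a => op (arrowClass I a)) where
  e_mul_e v := congrArg op (vertexClass_mul_self v)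
  e_mul_e_of_ne v v' h := congrArg op (vertexClass_mul_of_ne h.symm)
  e_mul_x a := congrArg op (arrowClass_mul_vertexClass a)
  x_mul_e a := congrArg op (vertexClass_mul_arrowClass a)
  x_mul_e_of_ne a v h := congrArg op (vertexClass_mul_arrowClass_of_ne h)
  adjoin_eq_top := by
    have h := Subalgebra.op_adjoin (R := k) (Set.range (vertexClass I) ∪ Set.range (arrowClass I))
    rw [adjoin_vertexClass_arrowClass] at h
    refine Eq.trans ?_ (h.symm.trans Subalgebra.op_top)
    congr 1
    ext y
    constructor
    · rintro (⟨v, rfl⟩ | ⟨a, rfl⟩)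
      exacts [Or.inl ⟨v, rfl⟩, Or.inr ⟨a, rfl⟩]
    · rintro (⟨v, hv⟩ | ⟨a, ha⟩)
      exacts [Or.inl ⟨v, congrArg op hv⟩, Or.inr ⟨a, congrArg op ha⟩]
  nilpotent := by
    obtain ⟨N, hN⟩ := hI.exists_prod_arrowClass_eq_zero
    refine ⟨N, fun l hl => ?_⟩
    have := hN l.reverse (by simpa using hl)
    rw [← unop_inj, unop_list_prod, unop_zero, ← this, List.map_map, List.map_reverse]
    rfl
  src_le_two a b c h h' := eq_or_eq_of_encard_le_two (hI.out_le b.left) h rfl h'.symm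
  mul_eq_zero_of_ne a b b' h h' hne hb := by
    rw [← op_mul, Ne, op_eq_zero_iff, arrowClass_mul_eq_zero_iff] at hne
    rw [← op_mul, op_eq_zero_iff, arrowClass_mul_eq_zero_iff]
    by_contra hn
    exact hb (hI.right_not_mem a b' b h'.symm h.symm hn hne)
  mul_eq_zero_or a a' b h h' hne := by
    rw [← op_mul, ← op_mul, op_eq_zero_iff, op_eq_zero_iff, arrowClass_mul_eq_zero_iff,
      arrowClass_mul_eq_zero_iff]
    by_contra! hn
    exact hne (hI.left_not_mem b a a' h h' hn.1 hn.2)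
  mul_x_eq_zero a a' r r' hne h := by
    obtain ⟨r, rfl⟩ := op_surjective r
    obtain ⟨r', rfl⟩ := op_surjective r'
    obtain ⟨r, rfl⟩ := I.ringCon.mkₐ_surjective (α := k) r
    obtain ⟨r', rfl⟩ := I.ringCon.mkₐ_surjective (α := k) r'
    rw [← op_mul, ← op_mul, ← MulOpposite.op_add, op_eq_zero_iff, arrowClass, arrowClass, ← map_mul,
      ← map_mul, ← map_add, mk_eq_zero_iff] at h
    rw [← op_mul, op_eq_zero_iff, arrowClass, ← map_mul, mk_eq_zero_iff]
    exact hI.ofArrow_mul_mem_of_add_mem hne h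
  mul_x_cancel a b r hne h := by
    obtain ⟨r, rfl⟩ := op_surjective r
    obtain ⟨r, rfl⟩ := I.ringCon.mkₐ_surjective (α := k) r
    rw [← op_mul, Ne, op_eq_zero_iff, arrowClass_mul_eq_zero_iff] at hne
    rw [← op_mul, ← op_mul, op_eq_zero_iff, arrowClass, arrowClass, ← map_mul, ← map_mul,
      mk_eq_zero_iff] at h
    rw [← op_mul, op_eq_zero_iff, arrowClass, ← map_mul, mk_eq_zero_iff]
    exact hI.ofArrow_mul_mem_of_mul_mem hne h
  eq_zero_of_mul_x a a' r hne hv hr h h' := by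
    obtain ⟨r, rfl⟩ := op_surjective r
    obtain ⟨r, rfl⟩ := I.ringCon.mkₐ_surjective (α := k) r
    rw [← op_mul, op_eq_zero_iff, arrowClass, ← map_mul, mk_eq_zero_iff] at h h'
    rw [← op_mul, op_inj, ← sub_eq_zero, vertexClass, ← map_mul, ← map_sub, mk_eq_zero_iff] at hr
    rw [op_eq_zero_iff, mk_eq_zero_iff]
    exact hI.mem_of_ofArrow_mul_mem hne hv hr h h'

/-- Finitely many arrows give countably many paths, so the path algebra embeds in a `u`-small space
of functions to `k`. This lets the resolutions be moved to the universe of the band module. -/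
theorem IsGentlePair.small_boundAlgebra (hI : IsGentlePair I) : Small.{u} (BoundAlgebra I) := by
  have hfin : Finite (Quiver.Total V) := by
    have h : (⋃ x : V, {a : Quiver.Total V | a.left = x}) = Set.univ := by
      ext a; simp
    rw [← Set.finite_univ_iff, ← h]
    exact Set.finite_iUnion fun x => Set.finite_of_encard_le_coe (k := 2) (hI.out_le x)
  have hcount : Countable (PathOf V) := by
    refine Function.Injective.countable (f := fun p : PathOf V => (p.src, arrows p.path))
      fun p q h => PathOf.ext_arrows (congrArg Prod.fst h) (congrArg Prod.snd h)
  have hs : Small.{u} (PathAlgebra k V) :=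
    small_of_injective (f := fun r : PathAlgebra k V => (fun p => coeff p r : PathOf V → k))
      fun r s h => Finsupp.ext fun p => congrFun h p
  exact small_of_surjective (I.ringCon.mkₐ_surjective (α := k))

end Gentle

/-! ## Band modules -/

/-! ### Reversal and rigidity of reduced words -/

section CyclicWords

variable {k ι R R' V E : Type*} [Field k] [Ring R] [Algebra k R] [Ring R'] [Algebra k R']
  {c : CyclicWord ι V E} {s t : E → V} {x : E → R} {x' : E → R'}

theorem CyclicWord.IsReduced.reverse (hc : c.IsReduced s t x)
    (hx : ∀ a b, x b * x a ≠ 0 → x' a * x' b ≠ 0) : c.reverse.IsReduced t s x' where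
  vert_src i := by rw [reverse_src]; exact hc.vert_tgt i
  vert_tgt i := by rw [reverse_tgt]; exact hc.vert_src i
  mul_ne_zero i hi hi' := hx _ _ (hc.mul_ne_zero' i (by simpa [CyclicWord.reverse] using hi)
    (by simpa [CyclicWord.reverse] using hi'))
  mul_ne_zero' i hi hi' := hx _ _ (hc.mul_ne_zero i (by simpa [CyclicWord.reverse] using hi)
    (by simpa [CyclicWord.reverse] using hi'))
  arr_ne i hi := hc.arr_ne i fun h => hi (congrArg Bool.not h)
  cyclic := hc.cyclic

/-- Distinct letters starting at one position are neighbours of opposite directions, and with equal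
arrows they would backtrack. Hence an arrow acts on the copy of `k ^ n` at a position through at
most one letter. -/
theorem CyclicWord.IsReduced.eq_of_src_eq (hc : c.IsReduced s t x) {i j : ι}
    (ha : c.arr i = c.arr j) (h : c.src i = c.src j) : i = j := by
  cases hi : c.dir i <;> cases hj : c.dir j <;>
    simp only [src, hi, hj, if_true, if_false, Bool.false_eq_true] at h
  · exact c.nxt.injective h
  · subst h; exact (hc.arr_ne i (by simp [hi, hj]) ha).elim
  · subst h; exact (hc.arr_ne j (by simp [hi, hj]) ha.symm).elim
  · exact h

theorem CyclicWord.IsReduced.eq_of_tgt_eq (hc : c.IsReduced s t x) {i j : ι}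
    (ha : c.arr i = c.arr j) (h : c.tgt i = c.tgt j) : i = j := by
  cases hi : c.dir i <;> cases hj : c.dir j <;>
    simp only [tgt, hi, hj, if_true, if_false, Bool.false_eq_true] at h
  · exact h
  · subst h; exact (hc.arr_ne j (by simp [hi, hj]) ha.symm).elim
  · subst h; exact (hc.arr_ne i (by simp [hi, hj]) ha).elim
  · exact c.nxt.injective h

end CyclicWords

/-! ### Band modules as modules of cyclic words -/

section Band

variable {k : Type u} [Field k] {V : Type v} [Quiver.{w} V]

namespace Letter

/-- Whether a letter is an arrow. -/
def isDir : Letter V → Bool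
  | dir _ => true
  | inv _ => false

/-- The arrow of a letter. -/
def arrow : Letter V → Quiver.Total V
  | dir a => a
  | inv a => a

end Letter

/-- The cyclic word of a list of letters. -/
def bandWord (b : List (Letter V)) : CyclicWord (Fin b.length) V (Quiver.Total V) where
  nxt := Equiv.ofBijective nextPos (Finite.injective_iff_bijective.1 nextPos_injective)
  dir i := (b.get i).isDir
  arr i := (b.get i).arrow
  vert i := (b.get i).src

theorem bandWord_nxt (b : List (Letter V)) (i : Fin b.length) : (bandWord b).nxt i = nextPos i := rfl

theorem nextPos_induction {m : ℕ} (p : Fin m → Prop) (h : ∀ i, p i → p (nextPos i)) (i j : Fin m)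
    (hi : p i) : p j := by
  have key : ∀ r : ℕ, p ⟨(i + r) % m, Nat.mod_lt _ i.pos⟩ := by
    intro r
    induction r with
    | zero => simpa [Nat.mod_eq_of_lt i.2] using hi
    | succ r ih =>
      have := h _ ih
      simpa [nextPos, Nat.add_assoc] using this
  -- Adding `m` keeps the subtraction of natural numbers from being truncated when `j < i`.
  have := key (j + m - i)
  have hij : ((i : ℕ) + (j + m - i)) % m = j := by
    have h1 : (i : ℕ) + (j + m - i) = j + m := by omega
    rw [h1, Nat.add_mod_right, Nat.mod_eq_of_lt j.2]
  simpa [hij] using this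

/-- The matrix of the action of the arrow of a letter of a band. -/
def letterMat (b : List (Letter V)) {n : ℕ} (J : Matrix (Fin n) (Fin n) k) (i : Fin b.length) :
    Matrix (Fin n) (Fin n) k :=
  if (bandWord b).dir i then bandMat b J i else (bandMat b J i)⁻¹

theorem isUnit_letterMat (b : List (Letter V)) {n : ℕ} {J : Matrix (Fin n) (Fin n) k}
    (hJ : IsUnit J) (i : Fin b.length) : IsUnit (letterMat b J i) := by
  have h : IsUnit (bandMat b J i) := by
    unfold bandMat
    split_ifs
    exacts [hJ, isUnit_one]
  unfold letterMat
  split_ifs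
  exacts [h, Matrix.isUnit_nonsing_inv_iff.2 h]

theorem isUnit_jordanBlock (n : ℕ) {l : k} (hl : l ≠ 0) : IsUnit (jordanBlock n l) := by
  rw [Matrix.isUnit_iff_isUnit_det, Matrix.det_of_isUpperTriangular]
  · exact isUnit_iff_ne_zero.2 (Finset.prod_ne_zero_iff.2 fun i _ => by simp [jordanBlock, hl])
  · intro i j hij
    have hij' : j < i := hij
    have h1 : i ≠ j := hij'.ne'
    have h2 : ¬ (i : ℕ) + 1 = j := by have : (j : ℕ) < i := hij'; omega
    simp [jordanBlock, h1, h2]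

open Classical in
-- Passing to source, target and `letterMat` merges the cases of direct and inverse letters.
theorem bandStep_eq (b : List (Letter V)) {n : ℕ} (J : Matrix (Fin n) (Fin n) k)
    (a : Quiver.Total V) (i : Fin b.length) : bandStep b J a i =
      if (bandWord b).arr i = a then
        LinearMap.single k (fun _ => Fin n → k) ((bandWord b).tgt i) ∘ₗ
          (letterMat b J i).mulVecLin ∘ₗ LinearMap.proj ((bandWord b).src i) else 0 := by
  unfold bandStep
  split <;> rename_i c hc
  · have h1 : (bandWord b).dir i = true := by simp only [bandWord, hc]; rfl
    have h2 : (bandWord b).arr i = c := by simp only [bandWord, hc]; rfl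
    simp only [letterMat, CyclicWord.tgt, CyclicWord.src, h1, h2, if_true, bandWord_nxt]
  · have h1 : (bandWord b).dir i = false := by simp only [bandWord, hc]; rfl
    have h2 : (bandWord b).arr i = c := by simp only [bandWord, hc]; rfl
    simp only [letterMat, CyclicWord.tgt, CyclicWord.src, h1, h2, if_false, bandWord_nxt,
      Bool.false_eq_true]

variable [Fintype V] {I : TwoSidedIdeal (PathAlgebra k V)} {b : List (Letter V)}

theorem IsBand.nonempty_fin (hb : IsBand I b) : Nonempty (Fin b.length) :=
  ⟨⟨0, List.length_pos_iff.2 hb.ne_nil⟩⟩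

open MulOpposite in
theorem IsBand.isReduced (hb : IsBand I b) :
    (bandWord b).IsReduced (fun a => a.left) (fun a => a.right) (fun a => op (arrowClass I a)) := by
  have hcomp := hb.cyclicallyComposable
  have hfol := hb.canFollow
  refine ⟨fun i => ?_, fun i => ?_, fun i hi hi' => ?_, fun i hi hi' => ?_, fun i hi => ?_,
    nextPos_induction⟩
  · have := hcomp i
    simp only [CyclicWord.src, bandWord, Equiv.ofBijective_apply]
    cases h : b.get i <;> rw [h] at this
    · simp only [Letter.isDir, if_true, h]; rfl
    · simp only [Letter.isDir, if_false, Bool.false_eq_true, ← this]; rfl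
  · have := hcomp i
    simp only [CyclicWord.tgt, bandWord, Equiv.ofBijective_apply]
    cases h : b.get i <;> rw [h] at this
    · simp only [Letter.isDir, if_true, ← this]; rfl
    · simp only [Letter.isDir, if_false, Bool.false_eq_true, h]; rfl
  · have := (hfol i).2.1
    rw [bandWord_nxt] at *
    rw [← op_mul, Ne, op_eq_zero_iff, arrowClass_mul_eq_zero_iff]
    simp only [bandWord] at *
    cases h : b.get i <;> cases h' : b.get (nextPos i) <;> rw [h] at this hi <;>
      rw [h'] at this hi'
    · exact this
    all_goals simp [Letter.isDir] at hi hi'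
  · have := (hfol i).2.1
    rw [bandWord_nxt] at *
    rw [← op_mul, Ne, op_eq_zero_iff, arrowClass_mul_eq_zero_iff]
    simp only [bandWord] at *
    cases h : b.get i <;> cases h' : b.get (nextPos i) <;> rw [h] at this hi <;>
      rw [h'] at this hi'
    on_goal 4 => exact this
    all_goals simp [Letter.isDir] at hi hi'
  · have := (hfol i).2.2
    rw [bandWord_nxt] at *
    simp only [bandWord] at *
    cases h : b.get i <;> cases h' : b.get (nextPos i) <;> rw [h] at this hi <;>
      rw [h'] at this hi
    · exact absurd rfl hi
    · exact this
    · exact this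
    · exact absurd rfl hi

theorem IsBand.bandArrow_single (hb : IsBand I b) {n : ℕ} (J : Matrix (Fin n) (Fin n) k)
    (i : Fin b.length) (z : Fin n → k) :
    bandArrow b J ((bandWord b).arr i)
        (Pi.single ((bandWord b).src i) z : BandSpace k b n) =
      Pi.single ((bandWord b).tgt i) ((letterMat b J i).mulVec z) := by
  classical
  rw [bandArrow, LinearMap.sum_apply, Finset.sum_eq_single i]
  · rw [bandStep_eq, if_pos rfl]
    simp
  · intro j _ hj
    rw [bandStep_eq]
    split_ifs with h
    · have hs : (bandWord b).src j ≠ (bandWord b).src i := fun hs =>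
        hj (hb.isReduced.eq_of_src_eq h hs)
      simp [hs]
    · rfl
  · simp

theorem IsBand.bandArrow_apply_tgt (hb : IsBand I b) {n : ℕ} (J : Matrix (Fin n) (Fin n) k)
    (i : Fin b.length) (m : BandSpace k b n) :
    bandArrow b J ((bandWord b).arr i) m ((bandWord b).tgt i) =
      (letterMat b J i).mulVec (m ((bandWord b).src i)) := by
  classical
  rw [bandArrow, LinearMap.sum_apply, Finset.sum_apply, Finset.sum_eq_single i]
  · rw [bandStep_eq, if_pos rfl]
    simp
  · intro j _ hj
    rw [bandStep_eq]
    split_ifs with h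
    · have hs : (bandWord b).tgt j ≠ (bandWord b).tgt i := fun hs =>
        hj (hb.isReduced.eq_of_tgt_eq h hs)
      simp [hs.symm]
    · rfl
  · simp

variable (hI : IsGentlePair I) (hb : IsBand I b) (n : ℕ) (l : k)

instance : Module k (bandModule hI hb n l) := inferInstanceAs (Module k (BandSpace k b n))

/-- The elements of the band module, as families of vectors. -/
def bandEquiv : bandModule hI hb n l ≃ₗ[k] BandSpace k b n := LinearEquiv.refl k _

open MulOpposite in
theorem bandEquiv_op_smul (r : PathAlgebra k V) (m : bandModule hI hb n l) :
    bandEquiv hI hb n l (op (I.ringCon.mkₐ k r) • m) =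
      bandLin b (jordanBlock n l) r (bandEquiv hI hb n l m) := rfl

open MulOpposite in
theorem bandEquiv_arrowClass_smul (a : Quiver.Total V) (m : bandModule hI hb n l) :
    bandEquiv hI hb n l (op (arrowClass I a) • m) =
      bandArrow b (jordanBlock n l) a (bandEquiv hI hb n l m) := by
  rw [arrowClass, bandEquiv_op_smul, bandLin_ofArrow hb.cyclicallyComposable]

open MulOpposite in
theorem bandEquiv_vertexClass_smul (v : V) (m : bandModule hI hb n l) :
    bandEquiv hI hb n l (op (vertexClass I v) • m) =
      bandIdem b n v (bandEquiv hI hb n l m) := by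
  rw [vertexClass, bandEquiv_op_smul, idem, bandLin_ofPath]
  rfl

instance : IsScalarTower k (BoundAlgebra I)ᵐᵒᵖ (bandModule hI hb n l) where
  smul_assoc c a m := by
    obtain ⟨a, rfl⟩ := MulOpposite.op_surjective a
    obtain ⟨r, rfl⟩ := I.ringCon.mkₐ_surjective (α := k) a
    rw [← MulOpposite.op_smul, ← map_smul]
    apply (bandEquiv hI hb n l).injective
    rw [bandEquiv_op_smul, map_smul, map_smul, bandEquiv_op_smul]
    rfl

open MulOpposite in
theorem bandModule_hasProjectiveDimensionLE_one (hl : l ≠ 0) :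
    HasProjectiveDimensionLE (bandModule hI hb n l) 1 := by
  classical
  have := hb.nonempty_fin
  have := hI.small_boundAlgebra
  have : Small.{u} (BoundAlgebra I)ᵐᵒᵖ := small_map MulOpposite.opEquiv.symm
  let φ := bandEquiv hI hb n l
  have hsum : ∀ z : Fin b.length → Fin n → k,
      ∑ j, ∑ r, z j r • φ.symm (Pi.single j (Pi.single r 1)) = φ.symm z := fun z => by
    simp only [← map_smul, ← map_sum]
    congr 1
    funext j r
    simp only [Finset.sum_apply, Pi.smul_apply]
    rw [Finset.sum_eq_single j, Finset.sum_eq_single r]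
    · simp
    · intro r' _ hr
      simp [hr.symm]
    · simp
    · intro j' _ hj
      exact Finset.sum_eq_zero fun r' _ => by simp [hj.symm]
    · simp
  refine hb.isReduced.hasProjectiveDimensionLE_one hI.isGentleSystem_op
    (isUnit_letterMat b (isUnit_jordanBlock n hl)) _
    (fun j r => φ.symm (Pi.single j (Pi.single r 1))) (fun j r => ?_) (fun i r => ?_)
    (fun z hz => ?_) fun m => ⟨φ m, ?_⟩
  · apply φ.injective
    rw [bandEquiv_vertexClass_smul, LinearEquiv.apply_symm_apply]
    exact (LinearMap.congr_fun (bandIdem_comp_single b n _ j) (Pi.single r 1)).trans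
      (by rw [if_pos (by rfl)]; rfl)
  · apply φ.injective
    rw [bandEquiv_arrowClass_smul, LinearEquiv.apply_symm_apply, hb.bandArrow_single]
    simp only [map_sum, map_smul, LinearEquiv.apply_symm_apply]
    funext j r'
    rw [Finset.sum_apply, Finset.sum_apply, Finset.sum_eq_single r']
    · by_cases hj : j = (bandWord b).tgt i
      · subst hj; simp
      · simp [hj]
    · intro r'' _ hr
      by_cases hj : j = (bandWord b).tgt i
      · subst hj; simp [hr.symm]
      · simp [hj]
    · simp
  · exact (LinearEquiv.map_eq_zero_iff φ.symm).1 ((hsum z).symm.trans hz)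
  · rw [hsum, LinearEquiv.symm_apply_apply]

/-- The coordinate functionals play the role of a basis of the dual. Arrows act on them by
transposed matrices and from target to source, whence the reversed word over `A` itself. -/
theorem bandModule_hasInjectiveDimensionLE_one (hl : l ≠ 0) :
    HasInjectiveDimensionLE (bandModule hI hb n l) 1 := by
  classical
  have := hb.nonempty_fin
  have := hI.small_boundAlgebra
  let φ := bandEquiv hI hb n l
  have hc : (bandWord b).reverse.IsReduced (fun a => a.right) (fun a => a.left) (arrowClass I) :=
    hb.isReduced.reverse fun a b h => fun h0 => h (congrArg MulOpposite.op h0)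
  refine hc.hasInjectiveDimensionLE_one hI.isGentleSystem
    (F := fun i => (letterMat b (jordanBlock n l) i).transpose)
    (fun i => (Matrix.isUnit_transpose _).2 (isUnit_letterMat b (isUnit_jordanBlock n hl) i)) _
    (fun j r => LinearMap.proj r ∘ₗ LinearMap.proj j ∘ₗ φ.toLinearMap)
    (fun j r m => ?_) (fun i r m => ?_) (fun m hm => ?_) fun z => ⟨φ.symm z, fun j r => ?_⟩
  · have h1 := congrFun (bandEquiv_vertexClass_smul hI hb n l ((bandWord b).vert j) m) j
    have h2 := LinearMap.congr_fun (proj_comp_bandIdem b n ((bandWord b).vert j) j) (φ m)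
    rw [if_pos (by rfl)] at h2
    exact congrFun (h1.trans h2) r
  · rw [CyclicWord.reverse_src, CyclicWord.reverse_tgt]
    have h1 := congrFun (bandEquiv_arrowClass_smul hI hb n l ((bandWord b).arr i) m)
      ((bandWord b).tgt i)
    exact congrFun (h1.trans (hb.bandArrow_apply_tgt _ i (φ m))) r
  · exact φ.injective (funext fun j => funext fun r => hm j r)
  · change φ (φ.symm z) j r = z j r
    rw [LinearEquiv.apply_symm_apply]

open MulOpposite in
-- Where two letters end at one position, invertibility of their matrices makes every vector there a
-- multiple of both arrows, although distinct arrows generate independent ideals.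
theorem not_projective_bandModule (hn : 1 ≤ n) (hl : l ≠ 0) :
    ¬ Projective (bandModule hI hb n l) := by
  intro hP
  have := hb.nonempty_fin
  have := hI.small_boundAlgebra
  have : Small.{u} (BoundAlgebra I)ᵐᵒᵖ := small_map MulOpposite.opEquiv.symm
  have := (bandModule hI hb n l).projective_of_module_projective
  let φ := bandEquiv hI hb n l
  let F := letterMat b (jordanBlock n l)
  have hF : ∀ i, IsUnit (F i).det := fun i => (Matrix.isUnit_iff_isUnit_det _).1
    (isUnit_letterMat b (isUnit_jordanBlock n hl) i)
  obtain ⟨i, hi, hi'⟩ := hb.isReduced.exists_true_false hI.isGentleSystem_op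
  have ht : (bandWord b).tgt ((bandWord b).nxt i) = (bandWord b).tgt i := by
    simp [CyclicWord.tgt, hi, hi']
  have hact : ∀ i, op (arrowClass I ((bandWord b).arr i)) •
      φ.symm (Pi.single ((bandWord b).src i) ((F i)⁻¹.mulVec 1)) =
        φ.symm (Pi.single ((bandWord b).tgt i) 1) := fun i => by
    apply φ.injective
    rw [bandEquiv_arrowClass_smul, LinearEquiv.apply_symm_apply, hb.bandArrow_single,
      Matrix.mulVec_mulVec, Matrix.mul_nonsing_inv _ (hF i), Matrix.one_mulVec,
      LinearEquiv.apply_symm_apply]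
  have h0 := eq_zero_of_projective (a := op (arrowClass I ((bandWord b).arr i)))
    (c := op (arrowClass I ((bandWord b).arr ((bandWord b).nxt i)))) (fun r r' h => by
      have h1 := congrArg unop h
      refine unop_injective ?_
      -- The sign turns the equality of two multiples into a vanishing sum.
      refine hI.isGentleSystem.mul_x_eq_zero _ _ r.unop (-r'.unop)
        (hb.isReduced.arr_ne i (by simp [hi, hi'])) ?_
      rw [neg_mul, add_neg_eq_zero]
      exact h1) ((hact i).trans (by rw [hact, ht]))
  rw [hact] at h0
  have h1 := congrFun (congrFun ((LinearEquiv.map_eq_zero_iff φ.symm).1 h0) ((bandWord b).tgt i))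
    ⟨0, hn⟩
  simp at h1

open MulOpposite in
-- Where two letters start at one position, injectivity would give `y` on which one arrow acts as on
-- a chosen nonzero vector and the other acts as zero.
theorem not_injective_bandModule (hn : 1 ≤ n) (hl : l ≠ 0) :
    ¬ Injective (bandModule hI hb n l) := by
  intro hP
  have := hb.nonempty_fin
  have := hI.small_boundAlgebra
  have : Small.{u} (BoundAlgebra I)ᵐᵒᵖ := small_map MulOpposite.opEquiv.symm
  have hB : Module.Baer (BoundAlgebra I)ᵐᵒᵖ (bandModule hI hb n l) :=
    Module.Baer.of_injective (Module.injective_module_of_injective_object _ _ (inj := hP))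
  let φ := bandEquiv hI hb n l
  let F := letterMat b (jordanBlock n l)
  have hF : ∀ i, Function.Injective (F i).mulVec := fun i =>
    Matrix.mulVec_injective_of_isUnit (isUnit_letterMat b (isUnit_jordanBlock n hl) i)
  have hc : (bandWord b).reverse.IsReduced (fun a => a.right) (fun a => a.left) (arrowClass I) :=
    hb.isReduced.reverse fun a b h => fun h0 => h (congrArg MulOpposite.op h0)
  obtain ⟨i, hi, hi'⟩ := hc.exists_true_false hI.isGentleSystem
  replace hi : (bandWord b).dir i = false := by simpa [CyclicWord.reverse] using hi
  replace hi' : (bandWord b).dir ((bandWord b).nxt i) = true := by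
    simpa [CyclicWord.reverse] using hi'
  have hs : (bandWord b).src ((bandWord b).nxt i) = (bandWord b).src i := by
    simp [CyclicWord.src, hi, hi']
  have hact : ∀ i m, φ (op (arrowClass I ((bandWord b).arr i)) • m) ((bandWord b).tgt i) =
      (F i).mulVec (φ m ((bandWord b).src i)) := fun i m => by
    rw [bandEquiv_arrowClass_smul, hb.bandArrow_apply_tgt]
  obtain ⟨y, hy, hy'⟩ := exists_smul_eq_of_baer hB (fun r r' h =>
    hI.isGentleSystem_op.mul_x_eq_zero _ _ r r' (hb.isReduced.arr_ne i (by simp [hi, hi'])) h)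
    (φ.symm (Pi.single ((bandWord b).src i) 1))
  have h1 := congrFun (congrArg φ hy) ((bandWord b).tgt i)
  rw [hact, hact, LinearEquiv.apply_symm_apply] at h1
  have h2 := congrFun (congrArg φ hy') ((bandWord b).tgt ((bandWord b).nxt i))
  rw [hact, map_zero, hs] at h2
  -- Both matrices are injective, so the component of `y` at the common source would be the all-ones
  -- vector and also zero.
  have h3 := (hF i h1).symm.trans (hF _ (h2.trans (Matrix.mulVec_zero _).symm))
  rw [Pi.single_eq_same] at h3
  exact one_ne_zero (congrFun h3 ⟨0, hn⟩)

end Band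

end GentleAlg

end

/-- Every band module `B(n, l)` over a gentle algebra has projective dimension `1` and injective
dimension `1`. -/
theorem proposition3p3 {k : Type u} [Field k] {V : Type v} [Fintype V] [Quiver.{w} V]
    {I : TwoSidedIdeal (GentleAlg.PathAlgebra k V)} (hI : GentleAlg.IsGentlePair I)
    {b : List (GentleAlg.Letter V)} (hb : GentleAlg.IsBand I b)
    (n : ℕ) (hn : 1 ≤ n) (l : k) (hl : l ≠ 0) :
    projectiveDimension (GentleAlg.bandModule hI hb n l) = 1 ∧
      injectiveDimension (GentleAlg.bandModule hI hb n l) = 1 := by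
  refine ⟨le_antisymm ?_ ?_, le_antisymm ?_ ?_⟩
  · exact (projectiveDimension_le_iff _ 1).2
      (GentleAlg.bandModule_hasProjectiveDimensionLE_one hI hb n l hl)
  · exact (projectiveDimension_ge_iff _ 1).2 fun h =>
      GentleAlg.not_projective_bandModule hI hb n l hn hl
        (projective_iff_hasProjectiveDimensionLT_one.2 h)
  · exact (injectiveDimension_le_iff _ 1).2
      (GentleAlg.bandModule_hasInjectiveDimensionLE_one hI hb n l hl)
  · exact (injectiveDimension_ge_iff _ 1).2 fun h =>
      GentleAlg.not_injective_bandModule hI hb n l hn hl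
        (injective_iff_hasInjectiveDimensionLT_one.2 h)
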